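/- (Canonical Typicality.) Let $\mathcal H_S$ and $\mathcal H_B$ be finite-dimensional complex Hilbert spaces and let $\mathcal H_R\subset\mathcal H_S\otimes\mathcal H_B$ be a nonzero linear subspace. Put $d_S=\dim\mathcal H_S$, $d_R=\dim\mathcal H_R$, let $P_R$ be the orthogonal projection onto $\mathcal H_R$, and let $\mathcal E_R=P_R/d_R$, $\Omega_S=\operatorname{tr}_B\mathcal E_R$, $\Omega_B=\operatorname{tr}_S\mathcal E_R$, where $\operatorname{tr}_B$ and $\operatorname{tr}_S$ denote the partial traces over $\mathcal H_B$ and $\mathcal H_S$. Define $$d_B^{\mathrm{eff}}=\frac{1}{\operatorname{tr}\Omega_B^2},\qquad C=\frac{1}{18\pi^3},\qquad \|T\|_1=\operatorname{tr}\sqrt{T^\dagger T}.$$ Let $|\phi\rangle$ be distributed according to the uniform probability measure on the unit sphere of $\mathcal H_R$, and let $\rho_S=\operatorname{tr}_B|\phi\rangle\langle\phi|$. Then for every $\varepsilon>0$ $$\mathrm{Prob}\left(\|\rho_S-\Omega_S\|_1\ge \varepsilon+\sqrt{\frac{d_S}{d_B^{\mathrm{eff}}}}\right)\le 2\exp\left(-C\,d_R\,\varepsilon^2\right).$$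 Moreover, $d_B^{\mathrm{eff}}\ge d_R/d_S$. -/

import Mathlib

open scoped TensorProduct
open MeasureTheory

noncomputable section

namespace CanonicalTypicality

/-- The partial trace over the bath `B` of an operator on `HS ⊗ HB`: the linear map determined by
`X ⊗ Y ↦ tr(Y) X`. -/
def traceB {HS HB : Type*} [NormedAddCommGroup HS] [InnerProductSpace ℂ HS]
    [FiniteDimensional ℂ HS] [NormedAddCommGroup HB] [InnerProductSpace ℂ HB]
    [FiniteDimensional ℂ HB] :
    (HS ⊗[ℂ] HB →ₗ[ℂ] HS ⊗[ℂ] HB) →ₗ[ℂ] (HS →ₗ[ℂ] HS) :=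
  (TensorProduct.rid ℂ (HS →ₗ[ℂ] HS)).toLinearMap ∘ₗ
    (LinearMap.trace ℂ HB).lTensor (HS →ₗ[ℂ] HS) ∘ₗ
    (homTensorHomEquiv ℂ HS HB HS HB).symm.toLinearMap

/-- The partial trace over the system `S` of an operator on `HS ⊗ HB`: the linear map determined by
`X ⊗ Y ↦ tr(X) Y`. -/
def traceS {HS HB : Type*} [NormedAddCommGroup HS] [InnerProductSpace ℂ HS]
    [FiniteDimensional ℂ HS] [NormedAddCommGroup HB] [InnerProductSpace ℂ HB]
    [FiniteDimensional ℂ HB] :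
    (HS ⊗[ℂ] HB →ₗ[ℂ] HS ⊗[ℂ] HB) →ₗ[ℂ] (HB →ₗ[ℂ] HB) :=
  (TensorProduct.lid ℂ (HB →ₗ[ℂ] HB)).toLinearMap ∘ₗ
    (LinearMap.trace ℂ HS).rTensor (HB →ₗ[ℂ] HB) ∘ₗ
    (homTensorHomEquiv ℂ HS HB HS HB).symm.toLinearMap

theorem traceB_map {HS HB : Type*} [NormedAddCommGroup HS] [InnerProductSpace ℂ HS]
    [FiniteDimensional ℂ HS] [NormedAddCommGroup HB] [InnerProductSpace ℂ HB]
    [FiniteDimensional ℂ HB] (X : HS →ₗ[ℂ] HS) (Y : HB →ₗ[ℂ] HB) :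
    traceB (TensorProduct.map X Y) = LinearMap.trace ℂ HB Y • X := by
  have h : (homTensorHomEquiv ℂ HS HB HS HB).symm (TensorProduct.map X Y) = X ⊗ₜ[ℂ] Y := by
    rw [LinearEquiv.symm_apply_eq]; simp [homTensorHomEquiv_apply]
  simp [traceB, h]

theorem traceS_map {HS HB : Type*} [NormedAddCommGroup HS] [InnerProductSpace ℂ HS]
    [FiniteDimensional ℂ HS] [NormedAddCommGroup HB] [InnerProductSpace ℂ HB]
    [FiniteDimensional ℂ HB] (X : HS →ₗ[ℂ] HS) (Y : HB →ₗ[ℂ] HB) :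
    traceS (TensorProduct.map X Y) = LinearMap.trace ℂ HS X • Y := by
  have h : (homTensorHomEquiv ℂ HS HB HS HB).symm (TensorProduct.map X Y) = X ⊗ₜ[ℂ] Y := by
    rw [LinearEquiv.symm_apply_eq]; simp [homTensorHomEquiv_apply]
  simp [traceS, h]

/-- The trace norm `‖T‖₁ = tr |T| = tr √(T† T)` of an operator on a finite-dimensional Hilbert
space. (The operator `|T|` is positive, so its trace is a nonnegative real number.) -/
def traceNorm {H : Type*} [NormedAddCommGroup H] [InnerProductSpace ℂ H]
    [FiniteDimensional ℂ H] (T : H →ₗ[ℂ] H) : ℝ :=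
  haveI : CompleteSpace H := FiniteDimensional.complete ℂ H
  (LinearMap.trace ℂ H (CFC.abs (LinearMap.toContinuousLinearMap T)).toLinearMap).re

/-- The uniform probability measure on the unit sphere of a finite-dimensional nonzero complex
Hilbert space: the normalized surface measure of the sphere of the underlying real Euclidean
space. -/
def uniformSphere (H : Type*) [NormedAddCommGroup H] [InnerProductSpace ℂ H]
    [FiniteDimensional ℂ H] [MeasurableSpace H] [BorelSpace H] :
    Measure (Metric.sphere (0 : H) 1) :=
  letI : InnerProductSpace ℝ H := InnerProductSpace.complexToReal
  ((volume : Measure H).toSphere Set.univ)⁻¹ • (volume : Measure H).toSphere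

section States

variable {HS HB : Type*} [NormedAddCommGroup HS] [InnerProductSpace ℂ HS]
  [FiniteDimensional ℂ HS] [NormedAddCommGroup HB] [InnerProductSpace ℂ HB]
  [FiniteDimensional ℂ HB]

/-- The reduced density matrix `ρ_S = tr_B |φ⟩⟨φ|` of the pure state `φ`. -/
def reducedState (φ : HS ⊗[ℂ] HB) : HS →ₗ[ℂ] HS :=
  traceB (InnerProductSpace.rankOne ℂ φ φ).toLinearMap

/-- The equiprobable state `E_R = P_R / d_R` on the subspace `HR`, where `P_R` is the orthogonal
projection onto `HR` and `d_R` its dimension. -/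
def equiprobableState (HR : Submodule ℂ (HS ⊗[ℂ] HB)) : HS ⊗[ℂ] HB →ₗ[ℂ] HS ⊗[ℂ] HB :=
  (Module.finrank ℂ HR : ℂ)⁻¹ • HR.starProjection.toLinearMap

/-- The canonical state `Ω_S = tr_B E_R` of the system. -/
def omegaS (HR : Submodule ℂ (HS ⊗[ℂ] HB)) : HS →ₗ[ℂ] HS := traceB (equiprobableState HR)

/-- The state `Ω_B = tr_S E_R` of the bath. -/
def omegaB (HR : Submodule ℂ (HS ⊗[ℂ] HB)) : HB →ₗ[ℂ] HB := traceS (equiprobableState HR)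

/-- The effective dimension `d_B^eff = 1 / tr(Ω_B²)` of the bath. (The trace of the square of the
self-adjoint operator `Ω_B` is a real number.) -/
def effDim (HR : Submodule ℂ (HS ⊗[ℂ] HB)) : ℝ :=
  1 / (LinearMap.trace ℂ HB (omegaB HR ∘ₗ omegaB HR)).re

end States

end CanonicalTypicality

end

/-! Let f(φ) = ‖ρ_S − Ω_S‖₁ on the unit sphere of H_R. Two facts suffice: f concentrates about its
mean, and the mean is at most √(d_S / d_B^eff).

Concentration. The trace norm of a self-adjoint T is the maximum of Re tr(UT) over contractions U,
and Re tr(U ρ_S) is the quadratic form of U ⊗ 1 at φ. Hence f is 2-Lipschitz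
(`abs_traceNorm_sub_le`). Lévy's lemma (`levy_concentration`) is derived from Gaussian
concentration. A Prékopa–Leindler inequality gives Maurey's bound E e^F · E e^{−F} ≤ e^{K²} for
K-Lipschitz F under the standard Gaussian. This is applied to a multiple of the homogeneous
extension of a centred function on the sphere. Two uses of Jensen bring the bound back to the
sphere, one of them averaging out the norm, which is independent of the direction. The exponent
obtained for H_R, of real dimension 2d_R, is (2d_R − 1)ε²/144, which beats C d_R ε².

Mean. By Cauchy–Schwarz, ‖T‖₁² ≤ d_S ‖T‖₂². Each matrix entry of ρ_S − Ω_S is a centred quadratic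
form of φ, given by the compression to H_R of a matrix unit |s_i⟩⟨s_j| ⊗ 1. Fourth moments of a
uniform vector bound the variance of the form of A by tr(A†A)/d_R²
(`integral_sq_inner_sub_trace_le`). Summed over all matrix units, these bounds give exactly tr Ω_B²
(`re_trace_omegaB_sq`), so E f² ≤ d_S tr Ω_B² = d_S / d_B^eff.

The same sum of Hilbert–Schmidt norms is at most d_R d_S (`compressedPurity_le`), which yields
d_B^eff ≥ d_R / d_S. -/

noncomputable section

/-! ### Midpoint Prékopa–Leindler inequalities -/

namespace CanonicalTypicality
open Set ENNReal

/-- One-dimensional Brunn–Minkowski inequality, midpoint form. -/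
theorem volume_add_volume_le_of_midpoint {A B C : Set ℝ} (hA : MeasurableSet A)
    (hB : MeasurableSet B) (hA0 : A.Nonempty) (hB0 : B.Nonempty)
    (h : ∀ x ∈ A, ∀ y ∈ B, (x + y) / 2 ∈ C) :
    volume A + volume B ≤ 2 * volume C := by
  have key : ∀ K L : Set ℝ, K ⊆ A → L ⊆ B → IsCompact K → IsCompact L → K.Nonempty →
      L.Nonempty → volume K + volume L ≤ 2 * volume C := by
    intro K L hKA hLB hK hL hK0 hL0
    obtain ⟨k, hk, hk'⟩ := hK.exists_isGreatest hK0
    obtain ⟨l, hl, hl'⟩ := hL.exists_isLeast hL0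
    have vol : ∀ (c : ℝ) (S : Set ℝ), volume ((fun x => (1 / 2 : ℝ) * x + c) '' S)
        = volume S / 2 := by
      intro c S
      have : (fun x : ℝ => (1 / 2 : ℝ) * x + c) '' S
          = (fun x => x + c) '' ((fun x => (1 / 2 : ℝ) • x) '' S) := by
        rw [image_image]; rfl
      rw [this, image_add_right, measure_preimage_add_right, image_smul, Measure.addHaar_smul]
      simp only [Module.finrank_self, pow_one]
      rw [abs_of_pos (by norm_num), one_div, ENNReal.ofReal_inv_of_pos (by norm_num),
        mul_comm, div_eq_mul_inv]
      norm_num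
    -- The midpoints of K with min L, and of L with max K, form half-size copies of K and L inside
    -- C. They lie on opposite sides of (k + l)/2, so they meet in at most one point and their
    -- volumes add.
    set K' := (fun x => (1 / 2 : ℝ) * x + l / 2) '' K with hK'
    set L' := (fun x => (1 / 2 : ℝ) * x + k / 2) '' L with hL'
    have hsub : K' ∪ L' ⊆ C := by
      rintro z (⟨x, hx, rfl⟩ | ⟨y, hy, rfl⟩)
      · have := h x (hKA hx) l (hLB hl)
        convert this using 1; simp only; ring
      · have := h k (hKA hk) y (hLB hy)
        convert this using 1; simp only; ring
    have hL'm : MeasurableSet L' := (hL.image (by fun_prop)).measurableSet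
    have hint : K' ∩ L' ⊆ {(k + l) / 2} := by
      rintro z ⟨⟨x, hx, rfl⟩, ⟨y, hy, hxy⟩⟩
      have h1 := hk' hx
      have h2 := hl' hy
      simp only [mem_singleton_iff] at hxy ⊢
      linarith
    have hzero : volume (K' ∩ L') = 0 :=
      measure_mono_null hint (by simp)
    have := measure_union_add_inter K' (μ := volume) hL'm
    rw [hzero, add_zero, vol, vol] at this
    calc volume K + volume L = 2 * (volume K / 2 + volume L / 2) := by
          rw [mul_add, ENNReal.mul_div_cancel (by norm_num) (by norm_num),
            ENNReal.mul_div_cancel (by norm_num) (by norm_num)]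
      _ = 2 * volume (K' ∪ L') := by rw [this]
      _ ≤ 2 * volume C := by gcongr
  obtain ⟨a, ha⟩ := hA0
  obtain ⟨b, hb⟩ := hB0
  rw [hA.measure_eq_iSup_isCompact, hB.measure_eq_iSup_isCompact]
  simp only [iSup_and']
  refine ENNReal.biSup_add_biSup_le' ⟨∅, empty_subset _, isCompact_empty⟩
    ⟨∅, empty_subset _, isCompact_empty⟩ ?_
  rintro K ⟨hK, hKc⟩ L ⟨hL, hLc⟩
  -- Inner regularity may supply empty compact sets; adjoining a and b makes them nonempty.
  refine (add_le_add (measure_mono (subset_insert a K)) (measure_mono (subset_insert b L))).trans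
    (key _ _ (insert_subset ha hK) (insert_subset hb hL) (hKc.insert a) (hLc.insert b)
      (insert_nonempty _ _) (insert_nonempty _ _))

/-- One-dimensional Prékopa–Leindler inequality for functions with supremum `1`, additive form. -/
theorem lintegral_add_lintegral_le_of_midpoint {u v m : ℝ → ℝ} (hu : Measurable u)
    (hv : Measurable v) (hm : Measurable m) (hu0 : 0 ≤ u) (hv0 : 0 ≤ v) (hm0 : 0 ≤ m)
    (hu1 : ∀ x, u x ≤ 1) (hv1 : ∀ x, v x ≤ 1) (hu2 : ∀ t < 1, ∃ x, t < u x)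
    (hv2 : ∀ t < 1, ∃ x, t < v x)
    (h : ∀ x y, min (u x) (v y) ≤ m ((x + y) / 2)) :
    (∫⁻ x, .ofReal (u x)) + (∫⁻ x, .ofReal (v x)) ≤ 2 * ∫⁻ x, .ofReal (m x) := by
  have lc : ∀ w : ℝ → ℝ, Measurable w → 0 ≤ w → ∫⁻ x, .ofReal (w x) =
      ∫⁻ t in Ioi 0, volume {x | t < w x} := fun w hw h0 =>
    lintegral_eq_lintegral_meas_lt volume (.of_forall h0) hw.aemeasurable
  rw [lc u hu hu0, lc v hv hv0, lc m hm hm0]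
  have am : ∀ w : ℝ → ℝ, Measurable fun t : ℝ => volume {x | t < w x} := fun w =>
    Antitone.measurable fun s t hst => measure_mono fun x (hx : t < w x) => hst.trans_lt hx
  rw [← lintegral_add_left (am u), ← lintegral_const_mul _ (am m)]
  refine lintegral_mono fun t => ?_
  -- Brunn–Minkowski is applied level by level. It needs nonempty sets, which supremum 1 guarantees
  -- below level 1; from level 1 on both superlevel sets are empty.
  by_cases ht : t < 1
  · refine volume_add_volume_le_of_midpoint (measurableSet_lt measurable_const hu)
      (measurableSet_lt measurable_const hv) (hu2 t ht) (hv2 t ht) fun x hx y hy => ?_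
    exact (lt_min hx hy).trans_le (h x y)
  · have e1 : {x | t < u x} = ∅ := by
      ext x; simpa using (hu1 x).trans (not_lt.mp ht)
    have e2 : {x | t < v x} = ∅ := by
      ext x; simpa using (hv1 x).trans (not_lt.mp ht)
    simp [e1, e2]

theorem mul_le_sq_of_add_le_two_mul {p q r : ℝ≥0∞} (hr : r ≠ ∞) (h : p + q ≤ 2 * r) :
    p * q ≤ r ^ 2 := by
  have h2 : 2 * r ≠ ∞ := ENNReal.mul_ne_top (by norm_num) hr
  have hp : p ≠ ∞ := ne_top_of_le_ne_top h2 (le_self_add.trans h)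
  have hq : q ≠ ∞ := ne_top_of_le_ne_top h2 (le_add_self.trans h)
  lift p to NNReal using hp
  lift q to NNReal using hq
  lift r to NNReal using hr
  norm_cast at h ⊢
  rw [← NNReal.coe_le_coe] at h ⊢
  push_cast at h ⊢
  nlinarith [sq_nonneg ((p : ℝ) - q), p.2, q.2, r.2]

theorem lintegral_gaussian_ne_top : ∫⁻ x : ℝ, .ofReal (Real.exp (-x ^ 2 / 2)) ≠ ∞ := by
  have := integrable_exp_neg_mul_sq (b := 1 / 2) (by norm_num)
  have h2 := this.lintegral_lt_top
  convert h2.ne using 4 with x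
  ring_nf

theorem exists_lt_toReal_div_iSup {w : ℝ → ℝ≥0∞} (h0 : ⨆ x, w x ≠ 0) (ht : ⨆ x, w x ≠ ∞)
    {t : ℝ} (h1 : t < 1) : ∃ x, t < (w x).toReal / (⨆ x, w x).toReal := by
  have hpos := ENNReal.toReal_pos h0 ht
  by_contra! hcon
  have : ⨆ x, w x ≤ ENNReal.ofReal (t * (⨆ x, w x).toReal) := by
    refine iSup_le fun x => ?_
    have hx := (div_le_iff₀ hpos).1 (hcon x)
    rw [← ENNReal.ofReal_toReal (ne_top_of_le_ne_top ht (le_iSup w x))]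
    exact ENNReal.ofReal_le_ofReal hx
  have h2 := ENNReal.toReal_mono ENNReal.ofReal_ne_top this
  rw [ENNReal.toReal_ofReal'] at h2
  rcases le_max_iff.1 h2 with h3 | h3
  · nlinarith
  · linarith

/-- Prékopa–Leindler inequality on the line, with a Gaussian as the dominating function. -/
theorem lintegral_mul_lintegral_le_gaussian {u v : ℝ → ℝ≥0∞} (hu : Measurable u)
    (hv : Measurable v) {C : ℝ≥0∞} (hC : C ≠ ∞)
    (h : ∀ x y, u x * v y ≤ C * .ofReal (Real.exp (-((x + y) / 2) ^ 2))) :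
    (∫⁻ x, u x) * (∫⁻ y, v y) ≤ C * (∫⁻ x : ℝ, .ofReal (Real.exp (-x ^ 2 / 2))) ^ 2 := by
  set G := ∫⁻ x : ℝ, ENNReal.ofReal (Real.exp (-x ^ 2 / 2)) with hG
  by_cases hu0 : ∀ x, u x = 0
  · simp [hu0]
  by_cases hv0 : ∀ x, v x = 0
  · simp [hv0]
  push Not at hu0 hv0
  obtain ⟨x0, hx0⟩ := hu0
  obtain ⟨y0, hy0⟩ := hv0
  set a := ⨆ x, u x with ha
  set b := ⨆ x, v x with hb
  have hua : ∀ x, u x ≤ a := fun x => le_iSup u x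
  have hvb : ∀ x, v x ≤ b := fun x => le_iSup v x
  have ha0 : a ≠ 0 := fun h0 => hx0 (le_antisymm (h0 ▸ hua x0) bot_le)
  have hb0 : b ≠ 0 := fun h0 => hy0 (le_antisymm (h0 ▸ hvb y0) bot_le)
  -- The Gaussian is at most 1, so the hypothesis bounds the product of the suprema. As neither
  -- vanishes, both are finite and u, v can be normalised.
  have hab : a * b ≤ C := by
    rw [ha, hb, ENNReal.iSup_mul]
    refine iSup_le fun x => ?_
    rw [ENNReal.mul_iSup]
    refine iSup_le fun y => (h x y).trans ?_
    conv_rhs => rw [← mul_one C]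
    gcongr
    rw [ENNReal.ofReal_le_one, Real.exp_le_one_iff]
    nlinarith [sq_nonneg ((x + y) / 2)]
  have habt : a * b ≠ ∞ := ne_top_of_le_ne_top hC hab
  have hat : a ≠ ∞ := fun e => habt (by rw [e, ENNReal.top_mul hb0])
  have hbt : b ≠ ∞ := fun e => habt (by rw [e, ENNReal.mul_top ha0])
  have hut : ∀ x, u x ≠ ∞ := fun x => ne_top_of_le_ne_top hat (hua x)
  have hvt : ∀ x, v x ≠ ∞ := fun x => ne_top_of_le_ne_top hbt (hvb x)
  have hapos : 0 < a.toReal := ENNReal.toReal_pos ha0 hat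
  have hbpos : 0 < b.toReal := ENNReal.toReal_pos hb0 hbt
  -- After normalisation the product is at most s·exp(−z²) at the midpoint z. The minimum is at most
  -- the geometric mean, hence at most √s·exp(−z²/2). The additive inequality then becomes
  -- multiplicative by AM–GM.
  set s := C.toReal / (a.toReal * b.toReal) with hs
  have hs0 : 0 ≤ s := by positivity
  have key := lintegral_add_lintegral_le_of_midpoint
    (u := fun x => (u x).toReal / a.toReal) (v := fun x => (v x).toReal / b.toReal)
    (m := fun x => Real.sqrt s * Real.exp (-x ^ 2 / 2))
    (by fun_prop) (by fun_prop) (by fun_prop) (fun x => by positivity) (fun x => by positivity)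
    (fun x => by positivity)
    (fun x => (div_le_one hapos).2 (ENNReal.toReal_mono hat (hua x)))
    (fun x => (div_le_one hbpos).2 (ENNReal.toReal_mono hbt (hvb x)))
    (fun t ht => exists_lt_toReal_div_iSup ha0 hat ht)
    (fun t ht => exists_lt_toReal_div_iSup hb0 hbt ht)
    (fun x y => by
      have h1 := ENNReal.toReal_mono (ENNReal.mul_ne_top hC ENNReal.ofReal_ne_top) (h x y)
      rw [ENNReal.toReal_mul, ENNReal.toReal_mul, ENNReal.toReal_ofReal (Real.exp_pos _).le] at h1
      have h2 : (u x).toReal / a.toReal * ((v y).toReal / b.toReal)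
          ≤ (Real.sqrt s * Real.exp (-((x + y) / 2) ^ 2 / 2)) ^ 2 := by
        rw [mul_pow, Real.sq_sqrt hs0, ← Real.exp_nat_mul, hs, div_mul_div_comm, div_mul_eq_mul_div]
        refine div_le_div_of_nonneg_right (h1.trans_eq ?_) (by positivity)
        congr 2
        push_cast; ring
      refine (sq_le_sq₀ (le_min (by positivity) (by positivity)) (by positivity)).1 (le_trans ?_ h2)
      rw [pow_two]
      have p1 : 0 ≤ (u x).toReal / a.toReal := by positivity
      have p2 : 0 ≤ (v y).toReal / b.toReal := by positivity
      exact mul_le_mul (min_le_left _ _) (min_le_right _ _) (le_min p1 p2) p1)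
  have e1 : ∫⁻ x, .ofReal ((u x).toReal / a.toReal) = (∫⁻ x, u x) / a := by
    rw [div_eq_mul_inv, ← lintegral_mul_const _ hu]
    refine lintegral_congr fun x => ?_
    rw [ENNReal.ofReal_div_of_pos hapos, ENNReal.ofReal_toReal (hut x), ENNReal.ofReal_toReal hat,
      div_eq_mul_inv]
  have e2 : ∫⁻ x, .ofReal ((v x).toReal / b.toReal) = (∫⁻ x, v x) / b := by
    rw [div_eq_mul_inv, ← lintegral_mul_const _ hv]
    refine lintegral_congr fun x => ?_
    rw [ENNReal.ofReal_div_of_pos hbpos, ENNReal.ofReal_toReal (hvt x), ENNReal.ofReal_toReal hbt,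
      div_eq_mul_inv]
  have e3 : ∫⁻ x : ℝ, .ofReal (Real.sqrt s * Real.exp (-x ^ 2 / 2)) =
      .ofReal (Real.sqrt s) * G := by
    rw [hG, ← lintegral_const_mul _ (by fun_prop)]
    exact lintegral_congr fun x => ENNReal.ofReal_mul (Real.sqrt_nonneg _)
  simp only [e1, e2, e3] at key
  have key2 := mul_le_sq_of_add_le_two_mul
    (ENNReal.mul_ne_top ENNReal.ofReal_ne_top lintegral_gaussian_ne_top) key
  rw [mul_pow, ← ENNReal.ofReal_pow (Real.sqrt_nonneg _), Real.sq_sqrt hs0, hs,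
    ENNReal.ofReal_div_of_pos (by positivity), ENNReal.ofReal_mul hapos.le,
    ENNReal.ofReal_toReal hat, ENNReal.ofReal_toReal hbt, ENNReal.ofReal_toReal hC] at key2
  have key3 := mul_le_mul_right key2 (a * b)
  have f1 : a * b * ((∫⁻ x, u x) / a * ((∫⁻ x, v x) / b)) = (∫⁻ x, u x) * ∫⁻ x, v x := by
    calc _ = (a * ((∫⁻ x, u x) / a)) * (b * ((∫⁻ x, v x) / b)) := by ring
      _ = _ := by rw [ENNReal.mul_div_cancel ha0 hat, ENNReal.mul_div_cancel hb0 hbt]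
  have f2 : a * b * (C / (a * b) * G ^ 2) = C * G ^ 2 := by
    rw [← mul_assoc, ENNReal.mul_div_cancel (mul_ne_zero ha0 hb0) habt]
  rwa [f1, f2] at key3

/-- Tensorised Prékopa–Leindler inequality with a Gaussian as the dominating function. -/
theorem lintegral_pi_mul_lintegral_pi_le_gaussian (n : ℕ) {u v : (Fin n → ℝ) → ℝ≥0∞}
    (hu : Measurable u) (hv : Measurable v) {C : ℝ≥0∞} (hC : C ≠ ∞)
    (h : ∀ x y, u x * v y ≤ C * .ofReal (Real.exp (-∑ i, ((x i + y i) / 2) ^ 2))) :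
    (∫⁻ x, u x) * (∫⁻ y, v y) ≤
      C * ((∫⁻ x : ℝ, .ofReal (Real.exp (-x ^ 2 / 2))) ^ 2) ^ n := by
  induction n generalizing C with
  | zero =>
    have := h default default
    simp only [Finset.univ_eq_empty, Finset.sum_empty, neg_zero, Real.exp_zero, ENNReal.ofReal_one,
      mul_one] at this
    simpa [volume_pi, Measure.pi_of_empty (x := default), lintegral_dirac] using this
  | succ n ih =>
    set G := ∫⁻ x : ℝ, ENNReal.ofReal (Real.exp (-x ^ 2 / 2)) with hG
    have hGt : (G ^ 2) ^ n ≠ ∞ := ENNReal.pow_ne_top (ENNReal.pow_ne_top lintegral_gaussian_ne_top)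
    have fub : ∀ w : (Fin (n + 1) → ℝ) → ℝ≥0∞, Measurable w →
        ∫⁻ x, w x = ∫⁻ s : ℝ, ∫⁻ x : Fin n → ℝ, w (Fin.cons s x) := by
      intro w hw
      have mp := (volume_preserving_piFinSuccAbove (fun _ : Fin (n + 1) => ℝ) 0).symm
      rw [← mp.lintegral_comp hw, Measure.volume_eq_prod, lintegral_prod _ (by fun_prop)]
      simp [MeasurableEquiv.piFinSuccAbove, Fin.insertNthEquiv]
    have mc : Measurable fun p : ℝ × (Fin n → ℝ) => (Fin.cons p.1 p.2 : Fin (n + 1) → ℝ) := by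
      refine measurable_pi_iff.2 fun i => ?_
      refine Fin.cases ?_ (fun j => ?_) i
      · simpa using measurable_fst
      · simp; fun_prop
    rw [fub u hu, fub v hv, pow_succ, ← mul_assoc]
    -- For fixed first coordinates s, t the slices satisfy the hypothesis with C times the Gaussian
    -- factor at (s + t)/2. By induction the marginals then satisfy the one-dimensional hypothesis.
    refine lintegral_mul_lintegral_le_gaussian (hu.comp mc).lintegral_prod_right'
      (hv.comp mc).lintegral_prod_right' (ENNReal.mul_ne_top hC hGt) fun s t => ?_
    rw [mul_right_comm]
    refine ih (by fun_prop) (by fun_prop) (ENNReal.mul_ne_top hC ENNReal.ofReal_ne_top)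
      fun x y => ?_
    refine (h _ _).trans_eq ?_
    rw [mul_assoc, ← ENNReal.ofReal_mul (Real.exp_pos _).le, ← Real.exp_add, Fin.sum_univ_succ]
    simp [add_comm]

theorem lintegral_euclidean_eq_pi {E : Type*} [NormedAddCommGroup E]
    [InnerProductSpace ℝ E] [FiniteDimensional ℝ E] [MeasurableSpace E] [BorelSpace E]
    (b : OrthonormalBasis (Fin (Module.finrank ℝ E)) ℝ E)
    {u : E → ℝ≥0∞} (hu : Measurable u) :
    ∫⁻ x, u x = ∫⁻ x : Fin (Module.finrank ℝ E) → ℝ, u (b.repr.symm (WithLp.toLp 2 x)) := by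
  rw [← b.measurePreserving_repr_symm.lintegral_comp hu,
    ← (PiLp.volume_preserving_toLp (Fin (Module.finrank ℝ E))).lintegral_comp]
  exact hu.comp (by fun_prop)

theorem norm_repr_symm_toLp_sq {E : Type*} [NormedAddCommGroup E]
    [InnerProductSpace ℝ E] {ι : Type*} [Fintype ι] (b : OrthonormalBasis ι ℝ E) (x : ι → ℝ) :
    ‖b.repr.symm (WithLp.toLp 2 x)‖ ^ 2 = ∑ i, x i ^ 2 := by
  rw [LinearIsometryEquiv.norm_map, EuclideanSpace.real_norm_sq_eq]

theorem lintegral_gaussian_euclidean {E : Type*} [NormedAddCommGroup E]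
    [InnerProductSpace ℝ E] [FiniteDimensional ℝ E] [MeasurableSpace E] [BorelSpace E] :
    ∫⁻ x : E, .ofReal (Real.exp (-‖x‖ ^ 2 / 2)) =
      (∫⁻ x : ℝ, .ofReal (Real.exp (-x ^ 2 / 2))) ^ Module.finrank ℝ E := by
  have h1 := GaussianFourier.integral_rexp_neg_mul_sq_norm (V := E) (b := 1 / 2) (by norm_num)
  have h2 := integral_gaussian (1 / 2)
  have i1 : Integrable fun x : E => Real.exp (-(1 / 2) * ‖x‖ ^ 2) := by
    refine Integrable.of_integral_ne_zero ?_
    rw [h1]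
    positivity
  have i2 := integrable_exp_neg_mul_sq (b := 1 / 2) (by norm_num)
  have e1 : ∀ r : ℝ, -r ^ 2 / 2 = -(1 / 2) * r ^ 2 := fun r => by ring
  simp_rw [e1]
  rw [← ofReal_integral_eq_lintegral_ofReal i1 (.of_forall fun _ => (Real.exp_pos _).le),
    ← ofReal_integral_eq_lintegral_ofReal i2 (.of_forall fun _ => (Real.exp_pos _).le), h1, h2,
    ← ENNReal.ofReal_pow (Real.sqrt_nonneg _), Real.sqrt_eq_rpow, ← Real.rpow_natCast,
    ← Real.rpow_mul (by positivity)]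
  congr 2
  ring

/-- Prékopa–Leindler inequality on a Euclidean space with a Gaussian as the dominating function. -/
theorem lintegral_mul_lintegral_le_gaussian_euclidean {E : Type*} [NormedAddCommGroup E]
    [InnerProductSpace ℝ E] [FiniteDimensional ℝ E] [MeasurableSpace E] [BorelSpace E]
    {u v : E → ℝ≥0∞} (hu : Measurable u) (hv : Measurable v) {C : ℝ≥0∞} (hC : C ≠ ∞)
    (h : ∀ x y, u x * v y ≤ C * .ofReal (Real.exp (-‖(1 / 2 : ℝ) • (x + y)‖ ^ 2))) :
    (∫⁻ x, u x) * (∫⁻ y, v y) ≤ C * (∫⁻ x : E, .ofReal (Real.exp (-‖x‖ ^ 2 / 2))) ^ 2 := by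
  rw [lintegral_gaussian_euclidean, lintegral_euclidean_eq_pi (stdOrthonormalBasis ℝ E) hu,
    lintegral_euclidean_eq_pi (stdOrthonormalBasis ℝ E) hv, ← pow_mul, mul_comm _ 2, pow_mul]
  refine lintegral_pi_mul_lintegral_pi_le_gaussian _ (hu.comp (by fun_prop))
    (hv.comp (by fun_prop)) hC fun x y => (h _ _).trans_eq ?_
  rw [← map_add, ← map_smul, ← WithLp.toLp_add, ← WithLp.toLp_smul, norm_repr_symm_toLp_sq]
  simp only [Pi.smul_apply, Pi.add_apply, smul_eq_mul]
  congr 5 with i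
  ring

end CanonicalTypicality

/-! ### The Gaussian measure and Maurey's inequality -/

namespace CanonicalTypicality
open Set ENNReal

section Gaussian

variable (E : Type*) [NormedAddCommGroup E] [InnerProductSpace ℝ E] [FiniteDimensional ℝ E]
  [MeasurableSpace E] [BorelSpace E]

/-- The standard Gaussian probability measure on a Euclidean space, given by its density. -/
def gaussian : Measure E :=
  (∫⁻ x : E, .ofReal (Real.exp (-‖x‖ ^ 2 / 2)))⁻¹ •
    volume.withDensity fun x : E => .ofReal (Real.exp (-‖x‖ ^ 2 / 2))

theorem lintegral_gaussian_density_ne_top :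
    ∫⁻ x : E, .ofReal (Real.exp (-‖x‖ ^ 2 / 2)) ≠ ∞ := by
  rw [lintegral_gaussian_euclidean]
  exact ENNReal.pow_ne_top lintegral_gaussian_ne_top

theorem lintegral_gaussian_density_ne_zero :
    ∫⁻ x : E, .ofReal (Real.exp (-‖x‖ ^ 2 / 2)) ≠ 0 := by
  intro h
  rw [lintegral_eq_zero_iff (by fun_prop)] at h
  obtain ⟨x, hx⟩ := h.exists
  simp only [Pi.zero_apply, ENNReal.ofReal_eq_zero] at hx
  exact (Real.exp_pos _).not_ge hx

instance : IsProbabilityMeasure (gaussian E) where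
  measure_univ := by
    rw [gaussian, Measure.smul_apply, withDensity_apply _ MeasurableSet.univ,
      Measure.restrict_univ, smul_eq_mul]
    exact ENNReal.inv_mul_cancel (lintegral_gaussian_density_ne_zero E)
      (lintegral_gaussian_density_ne_top E)

variable {E}

theorem lintegral_gaussian_eq {u : E → ℝ≥0∞} (hu : Measurable u) :
    ∫⁻ x, u x ∂gaussian E = (∫⁻ x : E, .ofReal (Real.exp (-‖x‖ ^ 2 / 2)))⁻¹ *
      ∫⁻ x, .ofReal (Real.exp (-‖x‖ ^ 2 / 2)) * u x := by
  rw [gaussian, lintegral_smul_measure, lintegral_withDensity_eq_lintegral_mul _ (by fun_prop) hu]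
  rfl

theorem integral_gaussian_eq (f : E → ℝ) :
    ∫ x, f x ∂gaussian E = (∫⁻ x : E, .ofReal (Real.exp (-‖x‖ ^ 2 / 2)))⁻¹.toReal *
      ∫ x, Real.exp (-‖x‖ ^ 2 / 2) * f x := by
  rw [gaussian, integral_smul_measure, integral_withDensity_eq_integral_toReal_smul (by fun_prop)
    (by simp)]
  simp [ENNReal.toReal_ofReal (Real.exp_pos _).le]

/-- Maurey's exponential inequality for Lipschitz functions of a Gaussian vector. -/
theorem lintegral_exp_mul_lintegral_exp_neg_le {F : E → ℝ} (hF : Measurable F) {K : ℝ}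
    (hK : ∀ x y, |F x - F y| ≤ K * ‖x - y‖) :
    (∫⁻ x, .ofReal (Real.exp (F x)) ∂gaussian E) * (∫⁻ x, .ofReal (Real.exp (-F x)) ∂gaussian E)
      ≤ .ofReal (Real.exp (K ^ 2)) := by
  rw [lintegral_gaussian_eq (by fun_prop), lintegral_gaussian_eq (by fun_prop)]
  set G := ∫⁻ x : E, ENNReal.ofReal (Real.exp (-‖x‖ ^ 2 / 2)) with hG
  have hGt : G ≠ ∞ := lintegral_gaussian_density_ne_top E
  have hG0 : G ≠ 0 := lintegral_gaussian_density_ne_zero E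
  have := lintegral_mul_lintegral_le_gaussian_euclidean
    (u := fun x : E => .ofReal (Real.exp (-‖x‖ ^ 2 / 2)) * .ofReal (Real.exp (F x)))
    (v := fun x : E => .ofReal (Real.exp (-‖x‖ ^ 2 / 2)) * .ofReal (Real.exp (-F x)))
    (C := .ofReal (Real.exp (K ^ 2))) (by fun_prop) (by fun_prop) ENNReal.ofReal_ne_top
    (fun x y => by
      have hp := fun a => (Real.exp_pos a).le
      rw [← ENNReal.ofReal_mul (hp _), ← ENNReal.ofReal_mul (hp _), ← ENNReal.ofReal_mul (hp _),
        ← ENNReal.ofReal_mul (by positivity), ← Real.exp_add, ← Real.exp_add, ← Real.exp_add,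
        ← Real.exp_add]
      -- By the parallelogram law, passing to the midpoint leaves −‖x − y‖²/4 in the exponent. With
      -- d = ‖x − y‖, the Lipschitz term is absorbed by Kd − d²/4 ≤ K².
      refine ENNReal.ofReal_le_ofReal (Real.exp_le_exp.2 ?_)
      have h1 := (le_abs_self _).trans (hK x y)
      have h2 := parallelogram_law_with_norm ℝ x y
      rw [norm_smul, mul_pow, Real.norm_eq_abs, sq_abs]
      nlinarith [sq_nonneg (K - ‖x - y‖ / 2)])
  calc _ = G⁻¹ * G⁻¹ * ((∫⁻ x : E, .ofReal (Real.exp (-‖x‖ ^ 2 / 2)) * .ofReal (Real.exp (F x))) *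
        ∫⁻ x : E, .ofReal (Real.exp (-‖x‖ ^ 2 / 2)) * .ofReal (Real.exp (-F x))) := by ring
    _ ≤ G⁻¹ * G⁻¹ * (.ofReal (Real.exp (K ^ 2)) * G ^ 2) := by gcongr
    _ = (G⁻¹ * G) * (G⁻¹ * G) * .ofReal (Real.exp (K ^ 2)) := by ring
    _ = _ := by rw [ENNReal.inv_mul_cancel hG0 hGt]; simp

/-! ### Polar coordinates and the mean Gaussian norm -/

/-- Integration in polar coordinates of a product of an angular and a radial function. -/
theorem integral_polar [Nontrivial E] {H : E → ℝ} {Φ : Metric.sphere (0 : E) 1 → ℝ} {ψ : ℝ → ℝ}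
    (h : ∀ r : ℝ, 0 < r → ∀ u : Metric.sphere (0 : E) 1, H (r • (u : E)) = Φ u * ψ r) :
    ∫ x, H x = (∫ u, Φ u ∂(volume : Measure E).toSphere) *
      ∫ r : Ioi (0 : ℝ), ψ r ∂Measure.volumeIoiPow (Module.finrank ℝ E - 1) := by
  calc ∫ x, H x = ∫ x : ({(0)}ᶜ : Set E), H x.1 ∂((volume : Measure E).comap Subtype.val) := by
        rw [integral_subtype_comap (measurableSet_singleton _).compl, restrict_compl_singleton]
    _ = ∫ p, Φ p.1 * ψ p.2 ∂(volume : Measure E).toSphere.prod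
          (.volumeIoiPow (Module.finrank ℝ E - 1)) := by
        rw [← (volume : Measure E).measurePreserving_homeomorphUnitSphereProd.integral_comp
          (Homeomorph.measurableEmbedding _)]
        refine integral_congr_ae (.of_forall fun x => ?_)
        simp only
        rw [← h _ (homeomorphUnitSphereProd E x).2.2]
        congr 1
        exact (congrArg Subtype.val ((homeomorphUnitSphereProd E).symm_apply_apply x)).symm
    _ = _ := integral_prod_mul Φ fun r : Ioi (0 : ℝ) => ψ r

/-- The normalised surface measure of the unit sphere. -/
def sphereMeasure (E : Type*) [NormedAddCommGroup E] [InnerProductSpace ℝ E]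
    [FiniteDimensional ℝ E] [MeasurableSpace E] [BorelSpace E] :
    Measure (Metric.sphere (0 : E) 1) :=
  ((volume : Measure E).toSphere Set.univ)⁻¹ • (volume : Measure E).toSphere

instance [Nontrivial E] : IsProbabilityMeasure (sphereMeasure E) where
  measure_univ := by
    rw [sphereMeasure, Measure.smul_apply, smul_eq_mul]
    exact ENNReal.inv_mul_cancel (Measure.measure_univ_ne_zero.2 (Measure.toSphere_ne_zero _))
      (measure_ne_top _ _)

/-- Under the Gaussian measure the direction is uniform and independent of the norm. -/
theorem integral_gaussian_polar [Nontrivial E] {H : E → ℝ} {Φ : Metric.sphere (0 : E) 1 → ℝ}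
    {ψ : ℝ → ℝ}
    (h : ∀ r : ℝ, 0 < r → ∀ u : Metric.sphere (0 : E) 1, H (r • (u : E)) = Φ u * ψ r) :
    ∫ x, H x ∂gaussian E = (∫ u, Φ u ∂sphereMeasure E) * ∫ x, ψ ‖x‖ ∂gaussian E := by
  have nrm : ∀ r : ℝ, 0 < r → ∀ u : Metric.sphere (0 : E) 1, ‖r • (u : E)‖ = r := by
    intro r hr u
    simp [norm_smul, abs_of_pos hr]
  rw [integral_gaussian_eq, integral_gaussian_eq,
    integral_polar (Φ := Φ) (ψ := fun r => Real.exp (-r ^ 2 / 2) * ψ r)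
      (fun r hr u => by rw [h r hr, nrm r hr]; ring),
    integral_polar (Φ := fun _ => 1) (ψ := fun r => Real.exp (-r ^ 2 / 2) * ψ r)
      (fun r hr u => by rw [nrm r hr]; ring), sphereMeasure, integral_smul_measure]
  have hne : (volume : Measure E).toSphere.real univ ≠ 0 := by
    simp [measureReal_def, ENNReal.toReal_eq_zero_iff, -Measure.toSphere_apply_univ]
  simp only [integral_const, smul_eq_mul, mul_one, ENNReal.toReal_inv]
  rw [← measureReal_def]
  field_simp

theorem integral_pow_mul_exp_neg_sq (k : ℕ) :
    ∫ r in Ioi (0 : ℝ), r ^ k * Real.exp (-r ^ 2 / 2) =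
      (1 / 2 : ℝ) ^ (-((k : ℝ) + 1) / 2) * (1 / 2) * Real.Gamma (((k : ℝ) + 1) / 2) := by
  rw [← integral_rpow_mul_exp_neg_mul_rpow (p := 2) (q := k) (b := 1 / 2) (by norm_num)
    (by linarith [k.cast_nonneg (α := ℝ)]) (by norm_num)]
  refine setIntegral_congr_fun measurableSet_Ioi fun r _ => ?_
  simp only [Real.rpow_natCast]
  congr 2
  norm_cast
  ring

/-- Log-convexity of Γ at the midpoint of x − 1/2 and x + 1/2. -/
theorem sq_Gamma_le {x : ℝ} (hx : 1 / 2 < x) :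
    Real.Gamma x ^ 2 ≤ Real.Gamma (x - 1 / 2) * Real.Gamma (x + 1 / 2) := by
  have h1 := Real.Gamma_pos_of_pos (show 0 < x - 1 / 2 by linarith)
  have h2 := Real.Gamma_pos_of_pos (show 0 < x + 1 / 2 by linarith)
  have h0 := Real.Gamma_pos_of_pos (show 0 < x by linarith)
  have h := Real.Gamma_mul_add_mul_le_rpow_Gamma_mul_rpow_Gamma
    (show 0 < x - 1 / 2 by linarith) (show 0 < x + 1 / 2 by linarith)
    (show (0 : ℝ) < 1 / 2 by norm_num) (show (0 : ℝ) < 1 / 2 by norm_num) (by norm_num)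
  have e : 1 / 2 * (x - 1 / 2) + 1 / 2 * (x + 1 / 2) = x := by ring
  rw [e, ← Real.sqrt_eq_rpow, ← Real.sqrt_eq_rpow] at h
  calc _ ≤ (√(Real.Gamma (x - 1 / 2)) * √(Real.Gamma (x + 1 / 2))) ^ 2 := by gcongr
    _ = _ := by rw [mul_pow, Real.sq_sqrt h1.le, Real.sq_sqrt h2.le]

theorem integral_norm_gaussian [Nontrivial E] :
    ∫ x, ‖x‖ ∂gaussian E = √2 * (Real.Gamma ((Module.finrank ℝ E : ℝ) / 2 + 1 / 2) /
      Real.Gamma ((Module.finrank ℝ E : ℝ) / 2)) := by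
  have hpos : 0 < Module.finrank ℝ E := Module.finrank_pos
  obtain ⟨k, hk⟩ : ∃ k, Module.finrank ℝ E = k + 1 := ⟨_, (Nat.succ_pred_eq_of_pos hpos).symm⟩
  have hG : (∫⁻ x : E, .ofReal (Real.exp (-‖x‖ ^ 2 / 2))).toReal =
      ∫ x : E, Real.exp (-‖x‖ ^ 2 / 2) := by
    rw [integral_eq_lintegral_of_nonneg_ae (.of_forall fun _ => (Real.exp_pos _).le)
      (by fun_prop)]
  rw [integral_gaussian_eq, ENNReal.toReal_inv, hG,
    integral_fun_norm_addHaar volume (fun r => Real.exp (-r ^ 2 / 2)),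
    integral_fun_norm_addHaar volume (fun r => Real.exp (-r ^ 2 / 2) * r), hk]
  simp only [nsmul_eq_mul, smul_eq_mul, add_tsub_cancel_right]
  have e : ∀ r : ℝ, r ^ k * (Real.exp (-r ^ 2 / 2) * r) = r ^ (k + 1) * Real.exp (-r ^ 2 / 2) :=
    fun r => by ring
  simp_rw [e]
  rw [integral_pow_mul_exp_neg_sq, integral_pow_mul_exp_neg_sq]
  have hb : (volume : Measure E).real (Metric.ball 0 1) ≠ 0 :=
    (ENNReal.toReal_pos (Metric.measure_ball_pos _ _ one_pos).ne' measure_ball_lt_top.ne).ne'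
  have hg : Real.Gamma (((k + 1 : ℕ) : ℝ) / 2) ≠ 0 :=
    (Real.Gamma_pos_of_pos (by positivity)).ne'
  have e2 : (1 / 2 : ℝ) ^ (-(((k + 1 : ℕ) : ℝ) + 1) / 2) = √2 * (1 / 2) ^ (-((k : ℝ) + 1) / 2) := by
    rw [Real.sqrt_eq_rpow, one_div, Real.inv_rpow (by norm_num), Real.inv_rpow (by norm_num),
      ← Real.rpow_neg (by norm_num), ← Real.rpow_neg (by norm_num), ← Real.rpow_add (by norm_num)]
    congr 1
    push_cast
    ring
  rw [e2]
  have e3 : (((k + 1 : ℕ) : ℝ) + 1) / 2 = ((k + 1 : ℕ) : ℝ) / 2 + 1 / 2 := by ring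
  rw [e3]
  push_cast at hg ⊢
  field_simp

/-- Log-convexity of Γ together with (x − 1/2) Γ(x − 1/2) = Γ(x + 1/2) at x = N/2. This lower bound
puts the dimension into the exponent of Lévy's lemma. -/
theorem sq_integral_norm_gaussian_ge (hN : 2 ≤ Module.finrank ℝ E) :
    (Module.finrank ℝ E : ℝ) - 1 ≤ (∫ x, ‖x‖ ∂gaussian E) ^ 2 := by
  have : Nontrivial E := Module.nontrivial_of_finrank_pos (R := ℝ) (by omega)
  rw [integral_norm_gaussian]
  have hN' : (2 : ℝ) ≤ Module.finrank ℝ E := by exact_mod_cast hN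
  set x := (Module.finrank ℝ E : ℝ) / 2 with hx
  have h1 := Real.Gamma_pos_of_pos (show 0 < x - 1 / 2 by linarith)
  have h2 := Real.Gamma_pos_of_pos (show 0 < x + 1 / 2 by linarith)
  have h0 := Real.Gamma_pos_of_pos (show 0 < x by linarith)
  have h3 := sq_Gamma_le (show 1 / 2 < x by linarith)
  have h4 := Real.Gamma_add_one (show x - 1 / 2 ≠ 0 by linarith)
  rw [show x - 1 / 2 + 1 = x + 1 / 2 by ring] at h4
  rw [mul_pow, div_pow, Real.sq_sqrt (by norm_num), ← mul_div_assoc, le_div_iff₀ (by positivity)]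
  have e : (Module.finrank ℝ E : ℝ) - 1 = 2 * (x - 1 / 2) := by rw [hx]; ring
  rw [e]
  calc 2 * (x - 1 / 2) * Real.Gamma x ^ 2
      ≤ 2 * (x - 1 / 2) * (Real.Gamma (x - 1 / 2) * Real.Gamma (x + 1 / 2)) := by
        refine mul_le_mul_of_nonneg_left h3 (by linarith)
    _ = 2 * Real.Gamma (x + 1 / 2) ^ 2 := by rw [h4]; ring

/-- The Bochner integral of a non-integrable function is 0, whereas the value computed above is
positive. -/
theorem integrable_norm_gaussian [Nontrivial E] : Integrable (fun x : E => ‖x‖) (gaussian E) := by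
  refine Integrable.of_integral_ne_zero ?_
  have hpos : 0 < Module.finrank ℝ E := Module.finrank_pos
  rw [integral_norm_gaussian]
  have h1 := Real.Gamma_pos_of_pos (show 0 < (Module.finrank ℝ E : ℝ) / 2 by positivity)
  have h2 := Real.Gamma_pos_of_pos (show 0 < (Module.finrank ℝ E : ℝ) / 2 + 1 / 2 by positivity)
  positivity

/-! ### Lévy's lemma on the real sphere -/

theorem norm_inv_norm_smul {E : Type*} [NormedAddCommGroup E] [NormedSpace ℝ E] {x : E}
    (hx : x ≠ 0) : ‖‖x‖⁻¹ • x‖ = 1 := by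
  rw [norm_smul, norm_inv, norm_norm, inv_mul_cancel₀ (norm_ne_zero_iff.2 hx)]

/-- The positively homogeneous extension of a Lipschitz function on the sphere is Lipschitz. -/
theorem lipschitz_homogeneous_extension {E : Type*} [NormedAddCommGroup E] [InnerProductSpace ℝ E]
    {g : E → ℝ} {L : ℝ}
    (hg : ∀ u v : E, ‖u‖ = 1 → ‖v‖ = 1 → |g u - g v| ≤ L * ‖u - v‖)
    (hb : ∀ u : E, ‖u‖ = 1 → |g u| ≤ 2 * L) (x y : E) :
    |‖x‖ * g (‖x‖⁻¹ • x) - ‖y‖ * g (‖y‖⁻¹ • y)| ≤ 3 * L * ‖x - y‖ := by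
  wlog h : ‖y‖ ≤ ‖x‖ generalizing x y
  · rw [abs_sub_comm, norm_sub_rev]
    exact this y x (le_of_not_ge h)
  rcases eq_or_ne x 0 with rfl | hx
  · have : y = 0 := by simpa using h
    simp [this]
  have hx' : ‖x‖ ≠ 0 := norm_ne_zero_iff.2 hx
  have n1 : ‖‖x‖⁻¹ • x‖ = 1 := norm_inv_norm_smul hx
  have hbx := hb _ n1
  have hL : 0 ≤ L := by linarith [abs_nonneg (g (‖x‖⁻¹ • x))]
  rcases eq_or_ne y 0 with rfl | hy
  · simp only [norm_zero, zero_mul, sub_zero, abs_mul, abs_norm]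
    nlinarith [norm_nonneg x, mul_nonneg hL (norm_nonneg x)]
  have hy' : ‖y‖ ≠ 0 := norm_ne_zero_iff.2 hy
  have n2 : ‖‖y‖⁻¹ • y‖ = 1 := norm_inv_norm_smul hy
  have h1 := hg _ _ n1 n2
  -- Radial projection of x to the sphere of radius ‖y‖ ≤ ‖x‖ does not increase its distance to y.
  -- This angular part contributes L to the constant 3L; the radial part contributes the bound 2L on
  -- |g|.
  have h2 : ‖y‖ * ‖‖x‖⁻¹ • x - ‖y‖⁻¹ • y‖ ≤ ‖x - y‖ := by
    have e1 : ‖y‖ * ‖‖x‖⁻¹ • x - ‖y‖⁻¹ • y‖ = ‖(‖y‖ / ‖x‖) • x - y‖ := by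
      conv_lhs => rw [← norm_norm y, ← norm_smul]
      rw [norm_norm, smul_sub, smul_smul, smul_smul, mul_inv_cancel₀ hy', one_smul, div_eq_mul_inv]
    rw [e1]
    refine (sq_le_sq₀ (norm_nonneg _) (norm_nonneg _)).1 ?_
    set c := ‖y‖ / ‖x‖ with hc
    have hc0 : 0 ≤ c := by positivity
    have hc1 : c ≤ 1 := (div_le_one (norm_pos_iff.2 hx)).2 h
    have hcy : ‖y‖ = c * ‖x‖ := by rw [hc]; field_simp
    rw [norm_sub_sq_real, norm_sub_sq_real, inner_smul_left, norm_smul, Real.norm_eq_abs,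
      abs_of_nonneg hc0, hcy]
    have hcs := real_inner_le_norm x y
    rw [hcy] at hcs
    simp only [conj_trivial]
    nlinarith [mul_nonneg (sub_nonneg.2 hc1) (sub_nonneg.2 hcs),
      mul_nonneg (sq_nonneg (1 - c)) (sq_nonneg ‖x‖)]
  have h3 : |‖x‖ - ‖y‖| ≤ ‖x - y‖ := abs_norm_sub_norm_le x y
  calc |‖x‖ * g (‖x‖⁻¹ • x) - ‖y‖ * g (‖y‖⁻¹ • y)|
      = |(‖x‖ - ‖y‖) * g (‖x‖⁻¹ • x) + ‖y‖ * (g (‖x‖⁻¹ • x) - g (‖y‖⁻¹ • y))| := by ring_nf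
    _ ≤ |‖x‖ - ‖y‖| * |g (‖x‖⁻¹ • x)| + ‖y‖ * |g (‖x‖⁻¹ • x) - g (‖y‖⁻¹ • y)| := by
        refine (abs_add_le _ _).trans ?_
        rw [abs_mul, abs_mul, abs_norm]
    _ ≤ ‖x - y‖ * (2 * L) + ‖y‖ * (L * ‖‖x‖⁻¹ • x - ‖y‖⁻¹ • y‖) := by gcongr
    _ ≤ ‖x - y‖ * (2 * L) + L * ‖x - y‖ := by nlinarith
    _ = _ := by ring

/-- Laplace transform bound for a mean-zero Lipschitz function on the sphere. -/
theorem integral_exp_sphere_le [Nontrivial E] {g : E → ℝ} {L : ℝ}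
    (hg : ∀ u v : E, ‖u‖ = 1 → ‖v‖ = 1 → |g u - g v| ≤ L * ‖u - v‖)
    (hb : ∀ u : E, ‖u‖ = 1 → |g u| ≤ 2 * L)
    (h0 : ∫ u, g (u : E) ∂sphereMeasure E = 0) {l : ℝ} (hl : 0 ≤ l) :
    ∫ u, Real.exp (l * (∫ x, ‖x‖ ∂gaussian E) * g (u : E)) ∂sphereMeasure E ≤
      Real.exp ((3 * L * l) ^ 2) := by
  set m := ∫ x, ‖x‖ ∂gaussian E with hm
  set F : E → ℝ := fun x => ‖x‖ * g (‖x‖⁻¹ • x) with hF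
  have hFlip : ∀ x y, |F x - F y| ≤ 3 * L * ‖x - y‖ := lipschitz_homogeneous_extension hg hb
  have hFm : Measurable F := by
    have : LipschitzWith (Real.toNNReal (3 * L)) F := LipschitzWith.of_dist_le_mul fun x y => by
      rw [Real.dist_eq, dist_eq_norm]
      refine (hFlip x y).trans ?_
      gcongr
      exact Real.le_coe_toNNReal _
    exact this.continuous.measurable
  have hFb : ∀ x, |F x| ≤ 2 * L * ‖x‖ := by
    intro x
    rcases eq_or_ne x 0 with rfl | hx
    · simp [hF]
    · have := hb _ (norm_inv_norm_smul hx)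
      simp only [hF, abs_mul, abs_norm]
      nlinarith [norm_nonneg x]
  have hin := integrable_norm_gaussian (E := E)
  have hFi : Integrable F (gaussian E) := by
    refine (hin.const_mul (2 * L)).mono' hFm.aestronglyMeasurable (.of_forall fun x => ?_)
    exact hFb x
  have hFr : ∀ r : ℝ, 0 < r → ∀ u : Metric.sphere (0 : E) 1, F (r • (u : E)) = g u * r := by
    intro r hr u
    have : ‖r • (u : E)‖ = r := by simp [norm_smul, abs_of_pos hr]
    simp only [hF, this, smul_smul, inv_mul_cancel₀ hr.ne', one_smul]
    ring
  have hF0 : ∫ x, F x ∂gaussian E = 0 := by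
    rw [integral_gaussian_polar (Φ := fun u => g u) (ψ := fun r => r) hFr, h0, zero_mul]
  have main := lintegral_exp_mul_lintegral_exp_neg_le (F := fun x => l * F x) (by fun_prop)
    (K := 3 * L * l) (fun x y => by
      rw [← mul_sub, abs_mul, abs_of_nonneg hl]
      nlinarith [mul_le_mul_of_nonneg_left (hFlip x y) hl])
  have pos : ∀ f : E → ℝ, Measurable f → ∫⁻ x, .ofReal (Real.exp (f x)) ∂gaussian E ≠ 0 := by
    intro f hf h
    rw [lintegral_eq_zero_iff (by fun_prop)] at h
    obtain ⟨x, hx⟩ := h.exists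
    simp only [Pi.zero_apply, ENNReal.ofReal_eq_zero] at hx
    exact (Real.exp_pos _).not_ge hx
  have fin : ∀ f : E → ℝ, Measurable f → ∫⁻ x, .ofReal (Real.exp (f x)) ∂gaussian E ≠ ∞ →
      Integrable (fun x => Real.exp (f x)) (gaussian E) := by
    intro f hf h
    refine ⟨by fun_prop, ?_⟩
    rw [hasFiniteIntegral_iff_ofReal (.of_forall fun _ => (Real.exp_pos _).le)]
    exact h.lt_top
  have ne1 := pos (fun x => l * F x) (by fun_prop)
  have ne2 := pos (fun x => -(l * F x)) (by fun_prop)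
  -- Exponential integrability comes from Maurey's bound itself: neither factor is 0, so a finite
  -- product forces both to be finite.
  have top1 : ∫⁻ x, .ofReal (Real.exp (l * F x)) ∂gaussian E ≠ ∞ := fun h => by
    rw [h, ENNReal.top_mul ne2] at main
    exact ENNReal.ofReal_ne_top (top_le_iff.1 main)
  have top2 : ∫⁻ x, .ofReal (Real.exp (-(l * F x))) ∂gaussian E ≠ ∞ := fun h => by
    rw [h, ENNReal.mul_top ne1] at main
    exact ENNReal.ofReal_ne_top (top_le_iff.1 main)
  have i1 := fin _ (by fun_prop) top1
  have i2 := fin _ (by fun_prop) top2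
  rw [← ofReal_integral_eq_lintegral_ofReal i1 (.of_forall fun _ => (Real.exp_pos _).le),
    ← ofReal_integral_eq_lintegral_ofReal i2 (.of_forall fun _ => (Real.exp_pos _).le),
    ← ENNReal.ofReal_mul (integral_nonneg fun _ => (Real.exp_pos _).le),
    ENNReal.ofReal_le_ofReal_iff (Real.exp_pos _).le] at main
  -- Jensen for the mean-zero F, through e^s ≥ 1 + s.
  have lower2 : 1 ≤ ∫ x, Real.exp (-(l * F x)) ∂gaussian E := by
    calc (1 : ℝ) = ∫ x, (1 - l * F x) ∂gaussian E := by
          rw [integral_sub (integrable_const _) (hFi.const_mul l), integral_const_mul, hF0]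
          simp
      _ ≤ _ := integral_mono ((integrable_const _).sub (hFi.const_mul l)) i2 fun x => by
          have := Real.add_one_le_exp (-(l * F x))
          simp only
          linarith
  -- The degree-zero angular part, so that F = h·‖x‖ separates direction from norm.
  set h : E → ℝ := fun x => F x / ‖x‖ with hh
  have hhm : Measurable h := by fun_prop
  have hhb : ∀ x, |h x| ≤ 2 * L := by
    intro x
    rcases eq_or_ne x 0 with rfl | hx
    · obtain ⟨z, hz⟩ := exists_ne (0 : E)
      simp only [hh, norm_zero, _root_.div_zero, abs_zero]
      exact (abs_nonneg _).trans (hb _ (norm_inv_norm_smul hz))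
    · rw [hh, abs_div, abs_norm, div_le_iff₀ (norm_pos_iff.2 hx)]
      exact hFb x
  have hhr : ∀ r : ℝ, 0 < r → ∀ u : Metric.sphere (0 : E) 1, h (r • (u : E)) = g u := by
    intro r hr u
    have : ‖r • (u : E)‖ = r := by simp [norm_smul, abs_of_pos hr]
    simp only [hh, this, hFr r hr u]
    field_simp
  have hebd : ∀ x, |Real.exp (l * m * h x)| ≤ Real.exp (l * |m| * (2 * L)) := by
    intro x
    rw [abs_of_pos (Real.exp_pos _)]
    refine Real.exp_le_exp.2 ?_
    calc l * m * h x ≤ |l * m * h x| := le_abs_self _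
      _ = l * |m| * |h x| := by rw [abs_mul, abs_mul, abs_of_nonneg hl]
      _ ≤ _ := by gcongr; exact hhb x
  have j1 : Integrable (fun x => Real.exp (l * m * h x)) (gaussian E) :=
    Integrable.of_bound (by fun_prop) _ (.of_forall hebd)
  have j2 : Integrable (fun x => Real.exp (l * m * h x) * (l * h x) * (‖x‖ - m)) (gaussian E) := by
    refine (hin.sub (integrable_const m)).bdd_mul
      (c := Real.exp (l * |m| * (2 * L)) * (l * (2 * L))) (by fun_prop) (.of_forall fun x => ?_)
    rw [Real.norm_eq_abs, abs_mul, abs_mul, abs_of_nonneg hl]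
    gcongr
    · exact hebd x
    · exact hhb x
  -- Jensen in the radial variable: replace ‖x‖ by its mean m using the tangent line of exp at
  -- l·m·h. The linear term integrates to zero because norm and direction are independent.
  have lower1 : ∫ u, Real.exp (l * m * g (u : E)) ∂sphereMeasure E ≤
      ∫ x, Real.exp (l * F x) ∂gaussian E := by
    calc ∫ u, Real.exp (l * m * g (u : E)) ∂sphereMeasure E
        = ∫ x, (Real.exp (l * m * h x) + Real.exp (l * m * h x) * (l * h x) * (‖x‖ - m))
            ∂gaussian E := by
          rw [integral_add j1 j2,
            integral_gaussian_polar (H := fun x => Real.exp (l * m * h x))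
              (Φ := fun u => Real.exp (l * m * g u)) (ψ := fun _ => 1)
              (fun r hr u => by rw [hhr r hr u, mul_one]),
            integral_gaussian_polar
              (H := fun x => Real.exp (l * m * h x) * (l * h x) * (‖x‖ - m))
              (Φ := fun u => Real.exp (l * m * g u) * (l * g u)) (ψ := fun r => r - m)
              (fun r hr u => by
                have : ‖r • (u : E)‖ = r := by simp [norm_smul, abs_of_pos hr]
                simp only [hhr r hr u, this]),
            integral_sub hin (integrable_const _), ← hm]
          simp
      _ ≤ _ := integral_mono (j1.add j2) i1 fun x => by
          have hx : F x = h x * ‖x‖ := by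
            rcases eq_or_ne x 0 with rfl | hx
            · simp [hF]
            · rw [hh]; field_simp [norm_ne_zero_iff.2 hx]
          have e : Real.exp (l * F x) =
              Real.exp (l * m * h x) * Real.exp (l * h x * (‖x‖ - m)) := by
            rw [← Real.exp_add, hx]; ring_nf
          have := Real.add_one_le_exp (l * h x * (‖x‖ - m))
          simp only
          rw [e]
          nlinarith [Real.exp_pos (l * m * h x)]
  calc _ ≤ ∫ x, Real.exp (l * F x) ∂gaussian E := lower1
    _ ≤ (∫ x, Real.exp (l * F x) ∂gaussian E) * ∫ x, Real.exp (-(l * F x)) ∂gaussian E :=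
        le_mul_of_one_le_right (integral_nonneg fun _ => (Real.exp_pos _).le) lower2
    _ ≤ _ := main

/-- Lévy's lemma: concentration of Lipschitz functions on the sphere about their mean. -/
theorem levy_concentration (hN : 2 ≤ Module.finrank ℝ E) {g : E → ℝ} {L : ℝ} (hL : 0 < L)
    (hg : ∀ u v : E, ‖u‖ = 1 → ‖v‖ = 1 → |g u - g v| ≤ L * ‖u - v‖) {t : ℝ} (ht : 0 ≤ t) :
    (sphereMeasure E).real {u | (∫ v, g (v : E) ∂sphereMeasure E) + t ≤ g (u : E)} ≤
      Real.exp (-(((Module.finrank ℝ E : ℝ) - 1) * t ^ 2 / (36 * L ^ 2))) := by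
  have : Nontrivial E := Module.nontrivial_of_finrank_pos (R := ℝ) (by omega)
  have hN' : (2 : ℝ) ≤ Module.finrank ℝ E := by exact_mod_cast hN
  set μ := ∫ v, g (v : E) ∂sphereMeasure E with hμ
  set m := ∫ x, ‖x‖ ∂gaussian E with hm
  have hm2 := sq_integral_norm_gaussian_ge hN
  rw [← hm] at hm2
  have hm0 : 0 < m := by
    refine lt_of_le_of_ne (integral_nonneg fun _ => norm_nonneg _) fun h => ?_
    rw [← h] at hm2
    norm_num at hm2
    linarith
  have nrm : ∀ u : Metric.sphere (0 : E) 1, ‖(u : E)‖ = 1 := fun u => by simp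
  have gc : Continuous fun u : Metric.sphere (0 : E) 1 => g (u : E) := by
    have : LipschitzWith (Real.toNNReal L) fun u : Metric.sphere (0 : E) 1 => g (u : E) :=
      LipschitzWith.of_dist_le_mul fun x y => by
        rw [Real.dist_eq, Subtype.dist_eq, dist_eq_norm, Real.coe_toNNReal _ hL.le]
        exact hg _ _ (nrm x) (nrm y)
    exact this.continuous
  have gi : Integrable (fun u : Metric.sphere (0 : E) 1 => g (u : E)) (sphereMeasure E) :=
    gc.integrable_of_hasCompactSupport (HasCompactSupport.of_compactSpace _)
  have h0 : ∫ u, (g (u : E) - μ) ∂sphereMeasure E = 0 := by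
    rw [integral_sub gi (integrable_const _)]
    simp [hμ]
  have hb : ∀ u : E, ‖u‖ = 1 → |g u - μ| ≤ 2 * L := by
    intro u hu
    have e : g u - μ = ∫ v, (g u - g (v : E)) ∂sphereMeasure E := by
      rw [integral_sub (integrable_const _) gi]
      simp [hμ]
    rw [e, ← Real.norm_eq_abs]
    refine (norm_integral_le_of_norm_le_const (C := 2 * L) (.of_forall fun v => ?_)).trans
      (by simp)
    refine (hg u v hu (nrm v)).trans ?_
    have := norm_sub_le u (v : E)
    rw [hu, nrm v] at this
    nlinarith
  -- The minimiser of the Chernoff exponent −l·m·t + 9L²l², with value −m²t²/(36L²).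
  set l := t * m / (18 * L ^ 2) with hl
  have hl0 : 0 ≤ l := by positivity
  have key := integral_exp_sphere_le (g := fun x => g x - μ) (L := L)
    (fun u v hu hv => by simpa using hg u v hu hv) hb h0 hl0
  rw [← hm] at key
  have ch := ProbabilityTheory.measure_ge_le_exp_mul_mgf (μ := sphereMeasure E)
    (X := fun u : Metric.sphere (0 : E) 1 => g (u : E) - μ) t (t := l * m) (by positivity)
    ((Real.continuous_exp.comp
      (continuous_const.mul (gc.sub continuous_const))).integrable_of_hasCompactSupport
        (HasCompactSupport.of_compactSpace _))
  have es : {u : Metric.sphere (0 : E) 1 | μ + t ≤ g (u : E)} =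
      {u : Metric.sphere (0 : E) 1 | t ≤ g (u : E) - μ} := by
    ext u
    simp only [mem_ofPred_eq]
    constructor <;> intro h <;> linarith
  rw [es]
  refine ch.trans ?_
  rw [ProbabilityTheory.mgf]
  calc _ ≤ Real.exp (-(l * m) * t) * Real.exp ((3 * L * l) ^ 2) := by gcongr
    _ = Real.exp (-(m ^ 2 * t ^ 2 / (36 * L ^ 2))) := by
        rw [← Real.exp_add, hl]
        congr 1
        field_simp
        ring
    _ ≤ _ := by
        refine Real.exp_le_exp.2 (neg_le_neg ?_)
        gcongr

end Gaussian

end CanonicalTypicality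

/-! ### Invariance of the sphere measure -/

namespace CanonicalTypicality

section Invariance

variable {E : Type*} [NormedAddCommGroup E] [InnerProductSpace ℝ E] [FiniteDimensional ℝ E]
  [MeasurableSpace E] [BorelSpace E]

theorem integral_gaussian_comp_isometry (U : E ≃ₗᵢ[ℝ] E) (f : E → ℝ) :
    ∫ x, f (U x) ∂gaussian E = ∫ x, f x ∂gaussian E := by
  rw [integral_gaussian_eq, integral_gaussian_eq,
    ← U.measurePreserving.integral_comp U.toHomeomorph.measurableEmbedding
      (fun x => Real.exp (-‖x‖ ^ 2 / 2) * f x)]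
  simp

/-- The sphere measure is the law of x/‖x‖ under the Gaussian, which is rotation invariant. -/
theorem integral_sphere_comp_isometry [Nontrivial E] (U : E ≃ₗᵢ[ℝ] E) (f : E → ℝ) :
    ∫ u, f (U (u : E)) ∂sphereMeasure E = ∫ u, f (u : E) ∂sphereMeasure E := by
  have key : ∀ g : E → ℝ, ∫ x, g (‖x‖⁻¹ • x) ∂gaussian E = ∫ u, g (u : E) ∂sphereMeasure E := by
    intro g
    rw [integral_gaussian_polar (H := fun x => g (‖x‖⁻¹ • x)) (Φ := fun u => g u) (ψ := fun _ => 1)]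
    · simp
    · intro r hr u
      have : ‖r • (u : E)‖ = r := by simp [norm_smul, abs_of_pos hr]
      simp only [this, smul_smul, inv_mul_cancel₀ hr.ne', one_smul, mul_one]
  rw [← key f, ← key fun x => f (U x),
    ← integral_gaussian_comp_isometry U fun x => f (‖x‖⁻¹ • x)]
  simp

end Invariance

theorem exists_isometryEquiv_apply_eq {H : Type*} [NormedAddCommGroup H]
    [InnerProductSpace ℂ H] [FiniteDimensional ℂ H] {u v : H} (hu : ‖u‖ = 1) (hv : ‖v‖ = 1) :
    ∃ U : H ≃ₗᵢ[ℂ] H, U u = v := by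
  have : Nontrivial H := ⟨u, 0, fun h => by simp [h] at hu⟩
  have hd : 0 < Module.finrank ℂ H := Module.finrank_pos
  have ext : ∀ w : H, ‖w‖ = 1 → ∃ b : OrthonormalBasis (Fin (Module.finrank ℂ H)) ℂ H,
      b ⟨0, hd⟩ = w := by
    intro w hw
    obtain ⟨b, hb⟩ := Orthonormal.exists_orthonormalBasis_extension_of_card_eq (𝕜 := ℂ) (E := H)
      (ι := Fin (Module.finrank ℂ H)) (by simp) (v := fun _ => w) (s := {⟨0, hd⟩})
      ⟨fun i => by simpa using hw, fun i j hij => (hij (Subsingleton.elim _ _)).elim⟩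
    exact ⟨b, hb _ rfl⟩
  obtain ⟨b, hb⟩ := ext u hu
  obtain ⟨c, hc⟩ := ext v hv
  refine ⟨b.equiv c (Equiv.refl _), ?_⟩
  rw [← hb, OrthonormalBasis.equiv_apply_basis, ← hc]
  rfl

/-! ### Moments and variances of quadratic forms on the complex sphere -/

section ComplexSphere

variable {H : Type*} [NormedAddCommGroup H] [InnerProductSpace ℂ H] [FiniteDimensional ℂ H]
  [MeasurableSpace H] [BorelSpace H]

theorem uniformSphere_eq : uniformSphere H =
    @sphereMeasure H _ InnerProductSpace.complexToReal _ _ _ := rfl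

instance [Nontrivial H] : IsProbabilityMeasure (uniformSphere H) :=
  letI : InnerProductSpace ℝ H := InnerProductSpace.complexToReal
  inferInstanceAs (IsProbabilityMeasure (sphereMeasure H))

theorem integral_uniformSphere_comp_isometry [Nontrivial H] (U : H ≃ₗᵢ[ℂ] H) (f : H → ℝ) :
    ∫ u, f (U (u : H)) ∂uniformSphere H = ∫ u, f (u : H) ∂uniformSphere H := by
  let _ : InnerProductSpace ℝ H := InnerProductSpace.complexToReal
  rw [uniformSphere_eq]
  exact integral_sphere_comp_isometry
    { toLinearEquiv := U.toLinearEquiv.restrictScalars ℝ, norm_map' := U.norm_map } f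

theorem integrable_uniformSphere [Nontrivial H] {f : H → ℝ} (hf : Continuous f) :
    Integrable (fun u : Metric.sphere (0 : H) 1 => f u) (uniformSphere H) :=
  haveI : ProperSpace H := FiniteDimensional.proper ℂ H
  (hf.comp continuous_subtype_val).integrable_of_hasCompactSupport
    (HasCompactSupport.of_compactSpace _)

/-- Unitaries act transitively on unit vectors, so the moment depends only on ‖w‖ and is homogeneous
in it. The constant is fixed later by summing over an orthonormal basis. -/
theorem exists_integral_inner_pow [Nontrivial H] (p : ℕ) :
    ∃ a : ℝ, ∀ w : H, ∫ u, ‖inner ℂ w (u : H)‖ ^ p ∂uniformSphere H = a * ‖w‖ ^ p := by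
  obtain ⟨e, he⟩ := exists_norm_eq H zero_le_one
  refine ⟨∫ u, ‖inner ℂ e (u : H)‖ ^ p ∂uniformSphere H, fun w => ?_⟩
  have hunit : ∀ w : H, ‖w‖ = 1 → ∫ u, ‖inner ℂ w (u : H)‖ ^ p ∂uniformSphere H =
      ∫ u, ‖inner ℂ e (u : H)‖ ^ p ∂uniformSphere H := by
    intro w hw
    obtain ⟨U, hU⟩ := exists_isometryEquiv_apply_eq he hw
    rw [← integral_uniformSphere_comp_isometry U fun u => ‖inner ℂ w u‖ ^ p]
    simp [← hU]
  rcases eq_or_ne w 0 with rfl | hw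
  · rcases Nat.eq_zero_or_pos p with rfl | hp
    · simp
    · simp [hp.ne']
  · have hw' : ‖w‖ ≠ 0 := norm_ne_zero_iff.2 hw
    rw [← hunit ((‖w‖⁻¹ : ℂ) • w) (norm_smul_inv_norm hw), ← integral_mul_const]
    refine integral_congr_ae (.of_forall fun u => ?_)
    simp only [inner_smul_left, norm_mul, mul_pow]
    simp [hw', mul_right_comm]

theorem integral_inner_sq [Nontrivial H] (w : H) :
    ∫ u, ‖inner ℂ w (u : H)‖ ^ 2 ∂uniformSphere H = ‖w‖ ^ 2 / Module.finrank ℂ H := by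
  obtain ⟨a, ha⟩ := exists_integral_inner_pow (H := H) 2
  have hd : (0 : ℝ) < Module.finrank ℂ H := by exact_mod_cast Module.finrank_pos
  set b := stdOrthonormalBasis ℂ H
  have h1 : ∑ i, ∫ u, ‖inner ℂ (b i) (u : H)‖ ^ 2 ∂uniformSphere H = 1 := by
    rw [← integral_finsetSum _ fun i _ =>
      integrable_uniformSphere (f := fun u => ‖inner ℂ (b i) u‖ ^ 2) (by fun_prop)]
    simp [b.sum_sq_norm_inner_right]
  simp only [ha, b.norm_eq_one, one_pow, mul_one, Finset.sum_const, Finset.card_univ,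
    Fintype.card_fin, nsmul_eq_mul] at h1
  rw [ha, eq_div_iff hd.ne', mul_right_comm, mul_comm a, h1, one_mul]

/-- Averaging over the four phases ±1, ±i removes the phase-dependent terms and isolates ‖p‖²‖q‖².
Mixed moments thereby reduce to fourth moments in a single direction. -/
theorem sum_norm_add_pow_four (p q : ℂ) :
    ‖p + q‖ ^ 4 + ‖p - q‖ ^ 4 + ‖p + Complex.I * q‖ ^ 4 + ‖p - Complex.I * q‖ ^ 4 =
      4 * (‖p‖ ^ 4 + ‖q‖ ^ 4 + 4 * (‖p‖ ^ 2 * ‖q‖ ^ 2)) := by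
  have e : ∀ z : ℂ, ‖z‖ ^ 4 = (z.re * z.re + z.im * z.im) ^ 2 := fun z => by
    rw [← Complex.normSq_apply, ← Complex.sq_norm]; ring
  simp only [e, Complex.sq_norm, Complex.normSq_apply]
  simp
  ring

/-- Joint moments of the squared coordinates of a uniform unit vector. -/
theorem integral_inner_sq_mul_inner_sq [Nontrivial H] {ι : Type*} [Fintype ι] [DecidableEq ι]
    (b : OrthonormalBasis ι ℂ H) (i j : ι) :
    ∫ u, ‖inner ℂ (b i) (u : H)‖ ^ 2 * ‖inner ℂ (b j) (u : H)‖ ^ 2 ∂uniformSphere H =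
      (1 + if i = j then 1 else 0) / (Module.finrank ℂ H * (Module.finrank ℂ H + 1)) := by
  obtain ⟨a, ha⟩ := exists_integral_inner_pow (H := H) 4
  have hd : (0 : ℝ) < Module.finrank ℂ H := by exact_mod_cast Module.finrank_pos
  have hint : ∀ w : H, Integrable (fun u : Metric.sphere (0 : H) 1 => ‖inner ℂ w (u : H)‖ ^ 4)
    (uniformSphere H) := fun w => integrable_uniformSphere (f := fun u => ‖inner ℂ w u‖ ^ 4)
      (by fun_prop)
  have hint2 : ∀ w z : H, Integrable (fun u : Metric.sphere (0 : H) 1 =>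
      ‖inner ℂ w (u : H)‖ ^ 2 * ‖inner ℂ z (u : H)‖ ^ 2) (uniformSphere H) := fun w z =>
    integrable_uniformSphere (f := fun u => ‖inner ℂ w u‖ ^ 2 * ‖inner ℂ z u‖ ^ 2) (by fun_prop)
  -- The four vectors b i + z • b j have squared norm 2, so the identity integrates to 16a = 4(2a +
  -- 4I), where I is the mixed moment.
  have off : ∀ i j, i ≠ j →
      ∫ u, ‖inner ℂ (b i) (u : H)‖ ^ 2 * ‖inner ℂ (b j) (u : H)‖ ^ 2 ∂uniformSphere H = a / 2 := by
    intro i j hij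
    have hn : ∀ z : ℂ, ‖z‖ = 1 → ‖b i + z • b j‖ ^ 4 = 4 := by
      intro z hz
      have h2 : ‖b i + z • b j‖ ^ 2 = 2 := by
        rw [norm_add_sq (𝕜 := ℂ), inner_smul_right, b.orthonormal.2 hij, norm_smul]
        simp [hz]
        norm_num
      calc ‖b i + z • b j‖ ^ 4 = (‖b i + z • b j‖ ^ 2) ^ 2 := by ring
        _ = 4 := by rw [h2]; norm_num
    have h := integral_congr_ae (μ := uniformSphere H) (.of_forall fun u =>
      sum_norm_add_pow_four (inner ℂ (b i) (u : H)) (inner ℂ (b j) (u : H)))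
    have e1 : ∀ u : H, inner ℂ (b i) u + inner ℂ (b j) u = inner ℂ (b i + (1 : ℂ) • b j) u := by
      intro u; rw [inner_add_left, inner_smul_left]; simp
    have e2 : ∀ u : H, inner ℂ (b i) u - inner ℂ (b j) u = inner ℂ (b i + (-1 : ℂ) • b j) u := by
      intro u; rw [inner_add_left, inner_smul_left]; simp [sub_eq_add_neg]
    have e3 : ∀ u : H, inner ℂ (b i) u + Complex.I * inner ℂ (b j) u =
        inner ℂ (b i + (-Complex.I) • b j) u := by
      intro u; rw [inner_add_left, inner_smul_left]; simp
    have e4 : ∀ u : H, inner ℂ (b i) u - Complex.I * inner ℂ (b j) u =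
        inner ℂ (b i + Complex.I • b j) u := by
      intro u; rw [inner_add_left, inner_smul_left]; simp [sub_eq_add_neg]
    simp only [e1, e2, e3, e4] at h
    have l1 := (integral_add (((hint (b i + (1 : ℂ) • b j)).add
      (hint (b i + (-1 : ℂ) • b j))).add (hint (b i + (-Complex.I) • b j)))
      (hint (b i + Complex.I • b j))).symm.trans h
    rw [integral_add' ((hint _).add (hint _)) (hint _), integral_add' (hint _) (hint _),
      integral_const_mul] at l1
    have l2 := integral_add ((hint (b i)).add (hint (b j))) ((hint2 (b i) (b j)).const_mul 4)
    rw [integral_add' (hint _) (hint _), integral_const_mul] at l2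
    have l3 := l1.trans (congrArg (4 * ·) l2)
    simp only [ha] at l3
    rw [hn _ (by simp), hn _ (by simp), hn _ (by simp), hn _ (by simp), b.norm_eq_one,
      b.norm_eq_one] at l3
    linarith
  have diag : ∀ i, ∫ u, ‖inner ℂ (b i) (u : H)‖ ^ 2 * ‖inner ℂ (b i) (u : H)‖ ^ 2
      ∂uniformSphere H = a := by
    intro i
    have := ha (b i)
    rw [b.norm_eq_one] at this
    simp only [← pow_add]
    simpa using this
  have val : ∀ i j, ∫ u, ‖inner ℂ (b i) (u : H)‖ ^ 2 * ‖inner ℂ (b j) (u : H)‖ ^ 2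
      ∂uniformSphere H = a / 2 * (1 + if i = j then 1 else 0) := by
    intro i j
    split_ifs with h
    · subst h; rw [diag]; ring
    · rw [off i j h]; ring
  have hcard : (Fintype.card ι : ℝ) = Module.finrank ℂ H := by
    rw [Module.finrank_eq_card_basis b.toBasis]
  -- Parseval on the unit sphere makes the moments sum to 1, which determines a.
  have tot : ∑ i, ∑ j, ∫ u, ‖inner ℂ (b i) (u : H)‖ ^ 2 * ‖inner ℂ (b j) (u : H)‖ ^ 2
      ∂uniformSphere H = 1 := by
    have : ∀ i, ∑ j, ∫ u, ‖inner ℂ (b i) (u : H)‖ ^ 2 * ‖inner ℂ (b j) (u : H)‖ ^ 2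
        ∂uniformSphere H = 1 / Module.finrank ℂ H := by
      intro i
      rw [← integral_finsetSum _ fun j _ => hint2 _ _]
      simp only [← Finset.mul_sum, b.sum_sq_norm_inner_right]
      have := integral_inner_sq (b i)
      rw [b.norm_eq_one] at this
      simpa using this
    simp only [this, Finset.sum_const, Finset.card_univ, nsmul_eq_mul, hcard]
    field_simp
  simp only [val, ← Finset.mul_sum, Finset.sum_add_distrib, Finset.sum_const, Finset.card_univ,
    nsmul_eq_mul, hcard, Finset.sum_ite_eq, Finset.mem_univ, if_true, mul_one] at tot
  rw [val, eq_div_iff (by positivity)]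
  linear_combination (1 + if i = j then 1 else 0) * tot

theorem trace_comp_self_eq_sum_eigenvalues_sq {V : Type*} [NormedAddCommGroup V]
    [InnerProductSpace ℂ V] [FiniteDimensional ℂ V] {A : V →ₗ[ℂ] V} (hA : A.IsSymmetric) :
    (LinearMap.trace ℂ V (A ∘ₗ A)).re = ∑ i, hA.eigenvalues rfl i ^ 2 := by
  rw [LinearMap.trace_eq_sum_inner _ (hA.eigenvectorBasis rfl), Complex.re_sum]
  refine Finset.sum_congr rfl fun i _ => ?_
  simp only [LinearMap.comp_apply, hA.apply_eigenvectorBasis, map_smul, inner_smul_right]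
  simp [pow_two, inner_self_eq_norm_sq_to_K]

theorem trace_eq_sum_eigenvalues {V : Type*} [NormedAddCommGroup V]
    [InnerProductSpace ℂ V] [FiniteDimensional ℂ V] {A : V →ₗ[ℂ] V} (hA : A.IsSymmetric) :
    LinearMap.trace ℂ V A = ((∑ i, hA.eigenvalues rfl i : ℝ) : ℂ) :=
  hA.trace_eq_sum_eigenvalues rfl

theorem inner_apply_self_eq_sum_eigenvalues {V : Type*} [NormedAddCommGroup V]
    [InnerProductSpace ℂ V] [FiniteDimensional ℂ V] {A : V →ₗ[ℂ] V} (hA : A.IsSymmetric) (v : V) :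
    inner ℂ v (A v) = ((∑ i, hA.eigenvalues rfl i * ‖inner ℂ (hA.eigenvectorBasis rfl i) v‖ ^ 2 : ℝ)
      : ℂ) := by
  rw [← (hA.eigenvectorBasis rfl).sum_inner_mul_inner, Complex.ofReal_sum]
  refine Finset.sum_congr rfl fun i _ => ?_
  rw [← hA, hA.apply_eigenvectorBasis, inner_smul_left, ← inner_conj_symm v]
  push_cast
  rw [← Complex.conj_mul']
  simp
  ring

/-- Variance of a quadratic form of a uniform unit vector, self-adjoint case. -/
theorem integral_sq_inner_sub_trace_le_of_isSymmetric [Nontrivial H] {A : H →ₗ[ℂ] H}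
    (hA : A.IsSymmetric) :
    ∫ u, ‖inner ℂ (u : H) (A u) - LinearMap.trace ℂ H A / Module.finrank ℂ H‖ ^ 2
      ∂uniformSphere H ≤
      (LinearMap.trace ℂ H (A ∘ₗ A)).re / (Module.finrank ℂ H : ℝ) ^ 2 := by
  have hd : (0 : ℝ) < Module.finrank ℂ H := by exact_mod_cast Module.finrank_pos
  set d : ℝ := (Module.finrank ℂ H : ℝ) with hdd
  set a := hA.eigenvalues (n := Module.finrank ℂ H) rfl with ha
  set b := hA.eigenvectorBasis (n := Module.finrank ℂ H) rfl with hb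
  set q : Fin (Module.finrank ℂ H) → H → ℝ := fun i u => ‖inner ℂ (b i) u‖ ^ 2 with hq
  have qc : ∀ i, Continuous (q i) := fun i => by simp only [hq]; fun_prop
  have e1 : ∀ u : H, ‖inner ℂ u (A u) - LinearMap.trace ℂ H A / Module.finrank ℂ H‖ ^ 2 =
      (∑ i, a i * q i u) ^ 2 - 2 * ((∑ i, a i) / d) * (∑ i, a i * q i u)
        + ((∑ i, a i) / d) ^ 2 := by
    intro u
    rw [inner_apply_self_eq_sum_eigenvalues hA, trace_eq_sum_eigenvalues hA,
      ← Complex.ofReal_natCast, ← Complex.ofReal_div, ← Complex.ofReal_sub]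
    rw [Complex.norm_real, Real.norm_eq_abs, sq_abs]
    ring
  have int1 : Integrable (fun u : Metric.sphere (0 : H) 1 => (∑ i, a i * q i u) ^ 2)
      (uniformSphere H) :=
    integrable_uniformSphere (f := fun u => (∑ i, a i * q i u) ^ 2) (by fun_prop)
  have int2 : Integrable (fun u : Metric.sphere (0 : H) 1 => ∑ i, a i * q i u)
      (uniformSphere H) :=
    integrable_uniformSphere (f := fun u => ∑ i, a i * q i u) (by fun_prop)
  have m1 : ∫ u, ∑ i, a i * q i (u : H) ∂uniformSphere H = (∑ i, a i) / d := by
    rw [integral_finsetSum _ fun i _ =>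
      integrable_uniformSphere (f := fun u => a i * q i u) (by fun_prop), Finset.sum_div]
    refine Finset.sum_congr rfl fun i _ => ?_
    rw [integral_const_mul]
    simp only [hq]
    rw [integral_inner_sq, b.norm_eq_one]
    ring
  have m2 : ∫ u, (∑ i, a i * q i (u : H)) ^ 2 ∂uniformSphere H =
      ((∑ i, a i) ^ 2 + ∑ i, a i ^ 2) / (d * (d + 1)) := by
    have e : ∀ u : H, (∑ i, a i * q i u) ^ 2 = ∑ i, ∑ j, a i * a j * (q i u * q j u) := by
      intro u
      rw [pow_two, Finset.sum_mul_sum]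
      exact Finset.sum_congr rfl fun i _ => Finset.sum_congr rfl fun j _ => by ring
    simp only [e]
    rw [integral_finsetSum _ fun i _ => integrable_uniformSphere
      (f := fun u => ∑ j, a i * a j * (q i u * q j u)) (by fun_prop)]
    have : ∀ i j, ∫ u, a i * a j * (q i (u : H) * q j (u : H)) ∂uniformSphere H =
        (a i * a j + if i = j then a i * a j else 0) / (d * (d + 1)) := by
      intro i j
      rw [integral_const_mul]
      simp only [hq]
      rw [integral_inner_sq_mul_inner_sq]
      split_ifs <;> ring
    have e3 : ∀ i, ∫ u, ∑ j, a i * a j * (q i (u : H) * q j (u : H)) ∂uniformSphere H =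
        ∑ j, (a i * a j + if i = j then a i * a j else 0) / (d * (d + 1)) := by
      intro i
      rw [integral_finsetSum _ fun j _ => integrable_uniformSphere
        (f := fun u => a i * a j * (q i u * q j u)) (by fun_prop)]
      exact Finset.sum_congr rfl fun j _ => this i j
    simp only [e3, ← Finset.sum_div, Finset.sum_add_distrib, Finset.sum_ite_eq, Finset.mem_univ,
      if_true, pow_two, Finset.sum_mul_sum]
  simp only [e1]
  have l1 := integral_add (int1.sub (int2.const_mul (2 * ((∑ i, a i) / d))))
    (integrable_const (((∑ i, a i) / d) ^ 2))
  rw [integral_sub' int1 (int2.const_mul _), integral_const_mul, m1, m2] at l1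
  simp only [integral_const, probReal_univ, smul_eq_mul, one_mul] at l1
  refine l1.le.trans ?_
  rw [trace_comp_self_eq_sum_eigenvalues_sq hA, ← ha]
  have s1 : 0 ≤ ∑ i, a i ^ 2 := Finset.sum_nonneg fun i _ => sq_nonneg _
  have s2 : 0 ≤ (∑ i, a i) ^ 2 := sq_nonneg _
  -- Relaxing d(d + 1) to d² makes the squared trace cancel exactly against the squared mean.
  have h1 : ((∑ i, a i) ^ 2 + ∑ i, a i ^ 2) / (d * (d + 1)) ≤
      ((∑ i, a i) ^ 2 + ∑ i, a i ^ 2) / d ^ 2 := by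
    gcongr
    nlinarith
  calc _ ≤ ((∑ i, a i) ^ 2 + ∑ i, a i ^ 2) / d ^ 2 -
        2 * ((∑ i, a i) / d) * ((∑ i, a i) / d) + ((∑ i, a i) / d) ^ 2 := by gcongr
    _ = _ := by ring

/-- Variance of the quadratic form of an arbitrary operator at a uniform unit vector. -/
theorem integral_sq_inner_sub_trace_le [Nontrivial H] (A : H →ₗ[ℂ] H) :
    ∫ u, ‖inner ℂ (u : H) (A u) - LinearMap.trace ℂ H A / Module.finrank ℂ H‖ ^ 2
      ∂uniformSphere H ≤
      (LinearMap.trace ℂ H (A.adjoint ∘ₗ A)).re / (Module.finrank ℂ H : ℝ) ^ 2 := by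
  -- Cartesian decomposition A = S + iT. The forms of S and T are real, so squared moduli add, and
  -- tr(A†A) = tr S² + tr T². The general case is needed because matrix units are not self-adjoint.
  set S : H →ₗ[ℂ] H := (2 : ℂ)⁻¹ • (A + A.adjoint) with hS
  set T : H →ₗ[ℂ] H := (-(2 : ℂ)⁻¹ * Complex.I) • (A - A.adjoint) with hT
  have hSs : S.IsSymmetric := by
    intro x y
    simp only [hS, LinearMap.smul_apply, LinearMap.add_apply, inner_smul_left, inner_smul_right,
      inner_add_left, inner_add_right, LinearMap.adjoint_inner_left, LinearMap.adjoint_inner_right]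
    simp [add_comm, map_ofNat (starRingEnd ℂ) 2]
  have hTs : T.IsSymmetric := by
    intro x y
    simp only [hT, LinearMap.smul_apply, LinearMap.sub_apply, inner_smul_left, inner_smul_right,
      inner_sub_left, inner_sub_right, LinearMap.adjoint_inner_left, LinearMap.adjoint_inner_right]
    simp [map_ofNat (starRingEnd ℂ) 2]
    ring
  have hAe : A = S + Complex.I • T := by
    rw [hS, hT, smul_smul]
    have : Complex.I * (-(2 : ℂ)⁻¹ * Complex.I) = 2⁻¹ := by
      linear_combination (-(2 : ℂ)⁻¹) * Complex.I_mul_I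
    rw [this, ← smul_add]
    module
  have hAa : A.adjoint = S - Complex.I • T := by
    rw [hS, hT, smul_smul]
    have : Complex.I * (-(2 : ℂ)⁻¹ * Complex.I) = 2⁻¹ := by
      linear_combination (-(2 : ℂ)⁻¹) * Complex.I_mul_I
    rw [this]
    module
  have htr : (LinearMap.trace ℂ H (A.adjoint ∘ₗ A)).re =
      (LinearMap.trace ℂ H (S ∘ₗ S)).re + (LinearMap.trace ℂ H (T ∘ₗ T)).re := by
    have : LinearMap.trace ℂ H (A.adjoint ∘ₗ A) =
        LinearMap.trace ℂ H (S ∘ₗ S) + LinearMap.trace ℂ H (T ∘ₗ T) := by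
      have hc : LinearMap.trace ℂ H (S ∘ₗ T) = LinearMap.trace ℂ H (T ∘ₗ S) :=
        LinearMap.trace_comp_comm' _ _
      rw [hAa]
      conv_lhs => rw [hAe]
      simp only [LinearMap.comp_add, LinearMap.sub_comp, LinearMap.comp_smul, LinearMap.smul_comp,
        map_add, map_sub, map_smul, smul_eq_mul, hc]
      linear_combination (-LinearMap.trace ℂ H (T ∘ₗ T)) * Complex.I_mul_I
    rw [this, Complex.add_re]
  have real : ∀ {B : H →ₗ[ℂ] H} (hB : B.IsSymmetric) (u : H),
      (inner ℂ u (B u) - LinearMap.trace ℂ H B / Module.finrank ℂ H).im = 0 := by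
    intro B hB u
    rw [inner_apply_self_eq_sum_eigenvalues hB, trace_eq_sum_eigenvalues hB,
      ← Complex.ofReal_natCast, ← Complex.ofReal_div, ← Complex.ofReal_sub, Complex.ofReal_im]
  have hpt : ∀ u : H, ‖inner ℂ u (A u) - LinearMap.trace ℂ H A / Module.finrank ℂ H‖ ^ 2 =
      ‖inner ℂ u (S u) - LinearMap.trace ℂ H S / Module.finrank ℂ H‖ ^ 2 +
      ‖inner ℂ u (T u) - LinearMap.trace ℂ H T / Module.finrank ℂ H‖ ^ 2 := by
    intro u
    have e : inner ℂ u (A u) - LinearMap.trace ℂ H A / Module.finrank ℂ H =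
        (inner ℂ u (S u) - LinearMap.trace ℂ H S / Module.finrank ℂ H) +
        Complex.I * (inner ℂ u (T u) - LinearMap.trace ℂ H T / Module.finrank ℂ H) := by
      conv_lhs => rw [hAe]
      simp only [LinearMap.add_apply, LinearMap.smul_apply, inner_add_right, inner_smul_right,
        map_add, map_smul, smul_eq_mul]
      ring
    rw [e]
    simp only [Complex.sq_norm, Complex.normSq_apply, Complex.add_re, Complex.add_im,
      Complex.mul_re, Complex.mul_im, Complex.I_re, Complex.I_im, real hSs, real hTs]
    ring
  have hcont : ∀ B : H →ₗ[ℂ] H, Continuous fun u : H =>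
      ‖inner ℂ u (B u) - LinearMap.trace ℂ H B / Module.finrank ℂ H‖ ^ 2 := by
    intro B
    have : Continuous B := B.continuous_of_finiteDimensional
    fun_prop
  simp only [hpt]
  rw [integral_add (integrable_uniformSphere (hcont S)) (integrable_uniformSphere (hcont T)), htr,
    add_div]
  exact add_le_add (integral_sq_inner_sub_trace_le_of_isSymmetric hSs)
    (integral_sq_inner_sub_trace_le_of_isSymmetric hTs)

end ComplexSphere

end CanonicalTypicality

/-! ### The trace norm: spectral formula, duality, comparison with Hilbert–Schmidt -/

namespace CanonicalTypicality
open InnerProductSpace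

section TraceNorm

variable {V : Type*} [NormedAddCommGroup V] [InnerProductSpace ℂ V] [FiniteDimensional ℂ V]

/-- The operator with eigenvalues |t i| in an eigenbasis of T is positive and squares to T†T, so it
is |T| by uniqueness of the positive square root. -/
theorem traceNorm_eq_sum_abs_eigenvalues {T : V →ₗ[ℂ] V} (hT : T.IsSymmetric) :
    traceNorm T = ∑ i, |hT.eigenvalues rfl i| := by
  have : CompleteSpace V := FiniteDimensional.complete ℂ V
  set t := hT.eigenvalues (n := Module.finrank ℂ V) rfl with ht
  set v := hT.eigenvectorBasis (n := Module.finrank ℂ V) rfl with hv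
  set D : V →L[ℂ] V := ∑ i, ((|t i| : ℝ) : ℂ) • rankOne ℂ (v i) (v i) with hD
  have hDv : ∀ j, D (v j) = ((|t j| : ℝ) : ℂ) • v j := by
    intro j
    simp only [hD, sum_apply, smul_apply, rankOne_apply]
    rw [Finset.sum_eq_single j]
    · simp
    · intro i _ hij
      rw [v.orthonormal.2 hij]
      simp
    · simp
  have hTv : ∀ j, T (v j) = (t j : ℂ) • v j := fun j => hT.apply_eigenvectorBasis rfl j
  have hD0 : 0 ≤ D := by
    rw [ContinuousLinearMap.nonneg_iff_isPositive]
    refine ContinuousLinearMap.isPositive_sum _ fun i _ => ?_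
    refine (isPositive_rankOne_self (v i)).smul_of_nonneg ?_
    exact_mod_cast abs_nonneg (t i)
  have hstar : star (LinearMap.toContinuousLinearMap T) = LinearMap.toContinuousLinearMap T := by
    rw [ContinuousLinearMap.star_eq_adjoint, eq_comm, ContinuousLinearMap.eq_adjoint_iff]
    intro x y
    exact hT x y
  have habs : CFC.abs (LinearMap.toContinuousLinearMap T) = D := by
    rw [CFC.abs, hstar]
    refine CFC.sqrt_unique ?_ hD0
    refine ContinuousLinearMap.coe_injective (v.toBasis.ext fun j => ?_)
    simp only [OrthonormalBasis.coe_toBasis, ContinuousLinearMap.coe_coe,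
      mul_apply_eq_comp, hDv, map_smul, LinearMap.coe_toContinuousLinearMap', hTv,
      smul_smul]
    rw [← Complex.ofReal_mul, ← Complex.ofReal_mul, abs_mul_abs_self]
  rw [traceNorm, habs, LinearMap.trace_eq_sum_inner _ v, Complex.re_sum]
  refine Finset.sum_congr rfl fun i _ => ?_
  simp only [ContinuousLinearMap.coe_coe, hDv, inner_smul_right]
  simp

/-- One half of the duality between trace norm and operator norm; the next lemma shows that the
bound is attained. -/
theorem re_trace_comp_le_traceNorm {T : V →ₗ[ℂ] V} (hT : T.IsSymmetric) {U : V →ₗ[ℂ] V}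
    (hU : ∀ x, ‖U x‖ ≤ ‖x‖) : (LinearMap.trace ℂ V (U ∘ₗ T)).re ≤ traceNorm T := by
  rw [traceNorm_eq_sum_abs_eigenvalues hT,
    LinearMap.trace_eq_sum_inner _ (hT.eigenvectorBasis rfl), Complex.re_sum]
  refine Finset.sum_le_sum fun i _ => ?_
  simp only [LinearMap.comp_apply, hT.apply_eigenvectorBasis, map_smul, inner_smul_right]
  refine (Complex.re_le_norm _).trans ?_
  have h1 := norm_inner_le_norm (𝕜 := ℂ) (hT.eigenvectorBasis rfl i)
    (U (hT.eigenvectorBasis rfl i))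
  have h2 := hU (hT.eigenvectorBasis rfl i)
  rw [(hT.eigenvectorBasis rfl).norm_eq_one] at h1 h2
  rw [norm_mul]
  simp only [Complex.coe_algebraMap, Complex.norm_real, Real.norm_eq_abs]
  nlinarith [abs_nonneg (hT.eigenvalues rfl i)]

theorem exists_contraction_re_trace_comp_eq {T : V →ₗ[ℂ] V} (hT : T.IsSymmetric) :
    ∃ U : V →ₗ[ℂ] V, (∀ x, ‖U x‖ ≤ ‖x‖) ∧
      (LinearMap.trace ℂ V (U ∘ₗ T)).re = traceNorm T := by
  set t := hT.eigenvalues (n := Module.finrank ℂ V) rfl with ht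
  set v := hT.eigenvectorBasis (n := Module.finrank ℂ V) rfl with hv
  have hTv : ∀ j, T (v j) = (t j : ℂ) • v j := fun j => hT.apply_eigenvectorBasis rfl j
  -- U = sign(T). Since sign 0 = 0 it need not be unitary, but being a contraction is enough.
  set U : V →ₗ[ℂ] V := ∑ i, ((SignType.sign (t i) : ℝ) : ℂ) • (rankOne ℂ (v i) (v i)).toLinearMap
    with hU
  have hin : ∀ j x, inner ℂ (v j) (U x) = ((SignType.sign (t j) : ℝ) : ℂ) * inner ℂ (v j) x := by
    intro j x
    simp only [hU, LinearMap.sum_apply, LinearMap.smul_apply, ContinuousLinearMap.coe_coe,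
      rankOne_apply, inner_sum, inner_smul_right]
    rw [Finset.sum_eq_single j]
    · simp
    · intro i _ hij
      rw [v.orthonormal.2 hij.symm]
      simp
    · simp
  refine ⟨U, fun x => ?_, ?_⟩
  · refine (sq_le_sq₀ (norm_nonneg _) (norm_nonneg _)).1 ?_
    rw [← v.sum_sq_norm_inner_right, ← v.sum_sq_norm_inner_right x]
    refine Finset.sum_le_sum fun i _ => ?_
    rw [hin, norm_mul, Complex.norm_real, mul_pow]
    refine mul_le_of_le_one_left (sq_nonneg _) ?_
    rcases lt_trichotomy (t i) 0 with h | h | h <;> simp [h]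
  · rw [traceNorm_eq_sum_abs_eigenvalues hT, LinearMap.trace_eq_sum_inner _ v, Complex.re_sum]
    refine Finset.sum_congr rfl fun i _ => ?_
    rw [LinearMap.comp_apply, hin, hTv, inner_smul_right]
    simp only [inner_self_eq_norm_sq_to_K, v.norm_eq_one]
    rw [← ht, ← sign_mul_self]
    simp

/-- Cauchy–Schwarz on the eigenvalues; the sum of their squares is the Hilbert–Schmidt norm, which
any orthonormal basis computes. -/
theorem traceNorm_sq_le {T : V →ₗ[ℂ] V} (hT : T.IsSymmetric) {ι : Type*} [Fintype ι]
    (s : OrthonormalBasis ι ℂ V) :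
    traceNorm T ^ 2 ≤ Module.finrank ℂ V * ∑ i, ∑ j, ‖inner ℂ (s i) (T (s j))‖ ^ 2 := by
  have h1 : ∑ i, ∑ j, ‖inner ℂ (s i) (T (s j))‖ ^ 2 = ∑ i, hT.eigenvalues rfl i ^ 2 := by
    rw [← trace_comp_self_eq_sum_eigenvalues_sq hT, LinearMap.trace_eq_sum_inner _ s,
      Complex.re_sum, Finset.sum_comm]
    refine Finset.sum_congr rfl fun j _ => ?_
    rw [LinearMap.comp_apply, ← hT, s.sum_sq_norm_inner_right]
    exact norm_sq_eq_re_inner (𝕜 := ℂ) _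
  rw [traceNorm_eq_sum_abs_eigenvalues hT, h1]
  have := sq_sum_le_card_mul_sum_sq (s := Finset.univ)
    (f := fun i : Fin (Module.finrank ℂ V) => |hT.eigenvalues rfl i|)
  simpa using this

end TraceNorm

end CanonicalTypicality

/-! ### Partial traces, compressions to H_R and the purity of Ω_B -/

namespace CanonicalTypicality
open InnerProductSpace

section PartialTrace

variable {HS HB : Type*} [NormedAddCommGroup HS] [InnerProductSpace ℂ HS]
  [FiniteDimensional ℂ HS] [NormedAddCommGroup HB] [InnerProductSpace ℂ HB]
  [FiniteDimensional ℂ HB]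

/-- The operator `U ⊗ 1` on `HS ⊗ HB`. -/
abbrev systemOp (HB : Type*) [NormedAddCommGroup HB] [InnerProductSpace ℂ HB]
    (U : HS →ₗ[ℂ] HS) : HS ⊗[ℂ] HB →ₗ[ℂ] HS ⊗[ℂ] HB := TensorProduct.map U LinearMap.id

theorem end_tensor_induction {p : (HS ⊗[ℂ] HB →ₗ[ℂ] HS ⊗[ℂ] HB) → Prop}
    (h0 : p 0) (hmap : ∀ Y Z, p (TensorProduct.map Y Z)) (hadd : ∀ X Y, p X → p Y → p (X + Y))
    (X : HS ⊗[ℂ] HB →ₗ[ℂ] HS ⊗[ℂ] HB) : p X := by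
  obtain ⟨t, rfl⟩ := (homTensorHomEquiv ℂ HS HB HS HB).surjective X
  induction t with
  | zero => rwa [map_zero]
  | tmul Y Z => simpa [homTensorHomEquiv_apply] using hmap Y Z
  | add a b ha hb => rw [map_add]; exact hadd _ _ ha hb

/-- The duality characterising the partial trace: it turns every statement about the reduced state
into one about U ⊗ 1 on the whole space. -/
theorem trace_comp_traceB (U : HS →ₗ[ℂ] HS) (X : HS ⊗[ℂ] HB →ₗ[ℂ] HS ⊗[ℂ] HB) :
    LinearMap.trace ℂ HS (U ∘ₗ traceB X) = LinearMap.trace ℂ _ (systemOp HB U ∘ₗ X) := by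
  induction X using end_tensor_induction with
  | h0 => simp
  | hmap Y Z =>
    rw [traceB_map, ← TensorProduct.map_comp, LinearMap.trace_tensorProduct', LinearMap.comp_smul,
      map_smul, LinearMap.id_comp, smul_eq_mul, mul_comm]
  | hadd X Y hX hY => rw [map_add, LinearMap.comp_add, map_add, hX, hY, LinearMap.comp_add, map_add]

theorem trace_adjoint {V : Type*} [NormedAddCommGroup V] [InnerProductSpace ℂ V]
    [FiniteDimensional ℂ V] (A : V →ₗ[ℂ] V) :
    LinearMap.trace ℂ V A.adjoint = starRingEnd ℂ (LinearMap.trace ℂ V A) := by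
  rw [LinearMap.trace_eq_sum_inner _ (stdOrthonormalBasis ℂ V),
    LinearMap.trace_eq_sum_inner _ (stdOrthonormalBasis ℂ V), map_sum]
  refine Finset.sum_congr rfl fun i _ => ?_
  rw [LinearMap.adjoint_inner_right, inner_conj_symm]

theorem traceB_adjoint (X : HS ⊗[ℂ] HB →ₗ[ℂ] HS ⊗[ℂ] HB) :
    traceB X.adjoint = (traceB X).adjoint := by
  induction X using end_tensor_induction with
  | h0 => simp
  | hmap Y Z =>
    rw [TensorProduct.adjoint_map, traceB_map, traceB_map, trace_adjoint]
    exact (map_smulₛₗ LinearMap.adjoint _ _).symm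
  | hadd X Y hX hY => simp [hX, hY]

theorem traceB_isSymmetric {X : HS ⊗[ℂ] HB →ₗ[ℂ] HS ⊗[ℂ] HB} (hX : X.IsSymmetric) :
    (traceB X).IsSymmetric := by
  rw [LinearMap.isSymmetric_iff_isSelfAdjoint, IsSelfAdjoint, LinearMap.star_eq_adjoint] at hX ⊢
  rw [← traceB_adjoint, hX]

/-- The matrix unit `|x⟩⟨y|`. -/
abbrev ketBra {V : Type*} [NormedAddCommGroup V] [InnerProductSpace ℂ V] (x y : V) :
    V →ₗ[ℂ] V := (rankOne ℂ x y).toLinearMap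

theorem trace_ketBra_comp {V : Type*} [NormedAddCommGroup V] [InnerProductSpace ℂ V]
    [FiniteDimensional ℂ V] (x y : V) (T : V →ₗ[ℂ] V) :
    LinearMap.trace ℂ V (ketBra x y ∘ₗ T) = inner ℂ y (T x) := by
  have : T ∘ₗ ketBra x y = ketBra (T x) y := by
    ext z
    simp
  rw [LinearMap.trace_comp_comm', this]
  exact trace_rankOne _ _

theorem trace_comp_ketBra {V : Type*} [NormedAddCommGroup V] [InnerProductSpace ℂ V]
    [FiniteDimensional ℂ V] (x y : V) (T : V →ₗ[ℂ] V) :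
    LinearMap.trace ℂ V (T ∘ₗ ketBra x y) = inner ℂ y (T x) := by
  rw [LinearMap.trace_comp_comm', trace_ketBra_comp]

/-- Both sides are bilinear, and on product operators A ⊗ B, A' ⊗ B' both equal tr A · tr A' ·
tr(BB'). This is what makes the summed variances equal to the purity of the bath state. -/
theorem sum_trace_matrixUnits_eq {ι : Type*} [Fintype ι] (s : OrthonormalBasis ι ℂ HS)
    (X Y : HS ⊗[ℂ] HB →ₗ[ℂ] HS ⊗[ℂ] HB) :
    ∑ i, ∑ j, LinearMap.trace ℂ _ (X ∘ₗ systemOp HB (ketBra (s j) (s i)) ∘ₗ Y ∘ₗ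
      systemOp HB (ketBra (s i) (s j))) = LinearMap.trace ℂ HB (traceS X ∘ₗ traceS Y) := by
  induction X using end_tensor_induction with
  | h0 => simp
  | hadd X X' hX hX' =>
    simp only [LinearMap.add_comp, map_add, Finset.sum_add_distrib, hX, hX']
  | hmap A B =>
    induction Y using end_tensor_induction with
    | h0 => simp
    | hadd Y Y' hY hY' =>
      simp only [LinearMap.add_comp, LinearMap.comp_add, map_add, Finset.sum_add_distrib, hY, hY']
    | hmap A' B' =>
      have e : ∀ i j, LinearMap.trace ℂ _ (TensorProduct.map A B ∘ₗ
          systemOp HB (ketBra (s j) (s i)) ∘ₗ TensorProduct.map A' B' ∘ₗ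
          systemOp HB (ketBra (s i) (s j))) =
          inner ℂ (s j) (A (s j)) * inner ℂ (s i) (A' (s i)) *
            LinearMap.trace ℂ HB (B ∘ₗ B') := by
        intro i j
        have : ketBra (s j) (s i) ∘ₗ A' ∘ₗ ketBra (s i) (s j) =
            (inner ℂ (s i) (A' (s i)) : ℂ) • ketBra (s j) (s j) := by
          ext z
          simp [smul_smul, mul_comm]
        rw [systemOp, systemOp, ← TensorProduct.map_comp, ← TensorProduct.map_comp,
          ← TensorProduct.map_comp, LinearMap.trace_tensorProduct', this, LinearMap.comp_smul,
          map_smul, trace_comp_ketBra, LinearMap.comp_id, LinearMap.id_comp, smul_eq_mul]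
        ring
      simp only [e, traceS_map]
      rw [LinearMap.smul_comp, LinearMap.comp_smul, map_smul, map_smul,
        LinearMap.trace_eq_sum_inner A s, LinearMap.trace_eq_sum_inner A' s, smul_eq_mul,
        smul_eq_mul]
      simp only [← Finset.sum_mul, ← Finset.mul_sum]
      ring

variable (HR : Submodule ℂ (HS ⊗[ℂ] HB))

/-- The compression of an operator to a subspace. -/
abbrev compress {V : Type*} [NormedAddCommGroup V] [InnerProductSpace ℂ V]
    [FiniteDimensional ℂ V] (K : Submodule ℂ V) (X : V →ₗ[ℂ] V) : K →ₗ[ℂ] K :=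
  K.orthogonalProjectionOnto.toLinearMap ∘ₗ X ∘ₗ K.subtype

theorem inner_compress {V : Type*} [NormedAddCommGroup V] [InnerProductSpace ℂ V]
    [FiniteDimensional ℂ V] (K : Submodule ℂ V) (X : V →ₗ[ℂ] V) (u v : K) :
    inner ℂ u (compress K X v) = inner ℂ (u : V) (X v) := by
  simp

theorem compress_adjoint {V : Type*} [NormedAddCommGroup V] [InnerProductSpace ℂ V]
    [FiniteDimensional ℂ V] (K : Submodule ℂ V) (X : V →ₗ[ℂ] V) :
    (compress K X).adjoint = compress K X.adjoint := by
  rw [eq_comm, LinearMap.eq_adjoint_iff]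
  intro x y
  rw [inner_compress, ← inner_conj_symm, inner_compress, inner_conj_symm,
    LinearMap.adjoint_inner_left]

theorem trace_compress {V : Type*} [NormedAddCommGroup V] [InnerProductSpace ℂ V]
    [FiniteDimensional ℂ V] (K : Submodule ℂ V) (X : V →ₗ[ℂ] V) :
    LinearMap.trace ℂ K (compress K X) =
      LinearMap.trace ℂ V (X ∘ₗ K.starProjection.toLinearMap) := by
  rw [compress, LinearMap.trace_comp_comm']
  rfl

theorem trace_compress_comp {V : Type*} [NormedAddCommGroup V] [InnerProductSpace ℂ V]
    [FiniteDimensional ℂ V] (K : Submodule ℂ V) (X Y : V →ₗ[ℂ] V) :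
    LinearMap.trace ℂ K (compress K X ∘ₗ compress K Y) =
      LinearMap.trace ℂ V (K.starProjection.toLinearMap ∘ₗ X ∘ₗ K.starProjection.toLinearMap
        ∘ₗ Y) := by
  have : compress K X ∘ₗ compress K Y = compress K (X ∘ₗ K.starProjection.toLinearMap ∘ₗ Y) := rfl
  rw [this, trace_compress, LinearMap.trace_comp_comm']

theorem adjoint_systemOp_ketBra (x y : HS) :
    (systemOp HB (ketBra x y)).adjoint = systemOp HB (ketBra y x) := by
  rw [systemOp, TensorProduct.adjoint_map]
  congr 1
  · rw [eq_comm, LinearMap.eq_adjoint_iff]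
    intro u v
    simp [inner_smul_left, inner_smul_right, mul_comm]
  · simp

theorem inner_reducedState_apply (x y : HS) (φ : HS ⊗[ℂ] HB) :
    inner ℂ x (reducedState φ y) = inner ℂ φ (systemOp HB (ketBra y x) φ) := by
  rw [← trace_ketBra_comp, reducedState, trace_comp_traceB, trace_comp_ketBra]

theorem trace_comp_reducedState (U : HS →ₗ[ℂ] HS) (φ : HS ⊗[ℂ] HB) :
    LinearMap.trace ℂ HS (U ∘ₗ reducedState φ) = inner ℂ φ (systemOp HB U φ) := by
  rw [reducedState, trace_comp_traceB, trace_comp_ketBra]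

/-- Together with `inner_reducedState_apply`, this makes the entries of ρ_S − Ω_S centred quadratic
forms of compressed matrix units. -/
theorem inner_omegaS_apply (x y : HS) :
    inner ℂ x (omegaS HR y) =
      LinearMap.trace ℂ HR (compress HR (systemOp HB (ketBra y x))) / Module.finrank ℂ HR := by
  rw [← trace_ketBra_comp, omegaS, trace_comp_traceB, equiprobableState, LinearMap.comp_smul,
    map_smul, trace_compress, smul_eq_mul, div_eq_mul_inv, mul_comm]

theorem reducedState_sub_omegaS_isSymmetric (φ : HS ⊗[ℂ] HB) :
    (reducedState φ - omegaS HR).IsSymmetric := by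
  refine LinearMap.IsSymmetric.sub (traceB_isSymmetric ?_) (traceB_isSymmetric ?_)
  · exact isSymmetric_rankOne_self φ
  · refine LinearMap.IsSymmetric.smul ?_ HR.starProjection_isSymmetric
    simp

/-- The squared Hilbert–Schmidt norm `tr (A† A)`. -/
def hilbertSchmidtSq {V : Type*} [NormedAddCommGroup V] [InnerProductSpace ℂ V]
    [FiniteDimensional ℂ V] (A : V →ₗ[ℂ] V) : ℝ :=
  (LinearMap.trace ℂ V (A.adjoint ∘ₗ A)).re

theorem hilbertSchmidtSq_eq_sum {V : Type*} [NormedAddCommGroup V] [InnerProductSpace ℂ V]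
    [FiniteDimensional ℂ V] (A : V →ₗ[ℂ] V) {ι : Type*} [Fintype ι]
    (b : OrthonormalBasis ι ℂ V) : hilbertSchmidtSq A = ∑ i, ‖A (b i)‖ ^ 2 := by
  rw [hilbertSchmidtSq, LinearMap.trace_eq_sum_inner _ b, Complex.re_sum]
  refine Finset.sum_congr rfl fun i _ => ?_
  rw [LinearMap.comp_apply, LinearMap.adjoint_inner_right]
  exact (norm_sq_eq_re_inner (𝕜 := ℂ) _).symm

theorem hilbertSchmidtSq_nonneg {V : Type*} [NormedAddCommGroup V] [InnerProductSpace ℂ V]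
    [FiniteDimensional ℂ V] (A : V →ₗ[ℂ] V) : 0 ≤ hilbertSchmidtSq A := by
  rw [hilbertSchmidtSq_eq_sum A (stdOrthonormalBasis ℂ V)]
  positivity

theorem hilbertSchmidtSq_eq_zero {V : Type*} [NormedAddCommGroup V] [InnerProductSpace ℂ V]
    [FiniteDimensional ℂ V] {A : V →ₗ[ℂ] V} (h : hilbertSchmidtSq A = 0) : A = 0 := by
  rw [hilbertSchmidtSq_eq_sum A (stdOrthonormalBasis ℂ V),
    Finset.sum_eq_zero_iff_of_nonneg fun _ _ => by positivity] at h
  refine (stdOrthonormalBasis ℂ V).toBasis.ext fun a => ?_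
  simpa using h a (Finset.mem_univ _)

/-- `∑ᵢⱼ tr (Aᵢⱼ† Aᵢⱼ)` for the compressions `Aᵢⱼ` of the matrix units `|sᵢ⟩⟨sⱼ| ⊗ 1`. -/
def compressedPurity {ι : Type*} [Fintype ι] (s : OrthonormalBasis ι ℂ HS) : ℝ :=
  ∑ i, ∑ j, hilbertSchmidtSq (V := HR) (compress HR (systemOp HB (ketBra (s i) (s j))))

theorem re_trace_omegaB_sq {ι : Type*} [Fintype ι] (s : OrthonormalBasis ι ℂ HS) :
    (LinearMap.trace ℂ HB (omegaB HR ∘ₗ omegaB HR)).re =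
      compressedPurity HR s / (Module.finrank ℂ HR : ℝ) ^ 2 := by
  have h := sum_trace_matrixUnits_eq s HR.starProjection.toLinearMap HR.starProjection.toLinearMap
  have e : compressedPurity HR s = (LinearMap.trace ℂ HB (traceS HR.starProjection.toLinearMap ∘ₗ
      traceS HR.starProjection.toLinearMap)).re := by
    rw [← h, Complex.re_sum]
    refine Finset.sum_congr rfl fun i _ => ?_
    rw [Complex.re_sum]
    refine Finset.sum_congr rfl fun j _ => ?_
    rw [hilbertSchmidtSq, compress_adjoint, adjoint_systemOp_ketBra]
    exact congrArg Complex.re (trace_compress_comp HR _ _)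
  rw [e, omegaB, equiprobableState, map_smul, LinearMap.smul_comp, LinearMap.comp_smul, map_smul,
    map_smul, smul_smul, smul_eq_mul]
  have : ((Module.finrank ℂ HR : ℂ)⁻¹ * (Module.finrank ℂ HR : ℂ)⁻¹) =
      ((((Module.finrank ℂ HR : ℝ) ^ 2)⁻¹ : ℝ) : ℂ) := by
    push_cast
    ring
  rw [this, Complex.re_ofReal_mul, div_eq_mul_inv, mul_comm]

theorem sum_compress_diagonal {ι : Type*} [Fintype ι] (s : OrthonormalBasis ι ℂ HS) :
    ∑ j, compress HR (systemOp HB (ketBra (s j) (s j))) = LinearMap.id := by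
  have h : ∑ j, ketBra (s j) (s j) = (LinearMap.id : HS →ₗ[ℂ] HS) := by
    ext x
    simp [s.sum_repr']
  have h2 : ∑ j, systemOp HB (ketBra (s j) (s j)) = LinearMap.id := by
    rw [← TensorProduct.map_id (R := ℂ), ← h]
    exact (map_sum (TensorProduct.mapBilinear (.id ℂ) HS HB HS HB |>.flip LinearMap.id) _ _).symm
  ext1 x
  simp only [LinearMap.sum_apply, LinearMap.comp_apply]
  rw [← map_sum]
  have := congrArg (fun f => f (x : HS ⊗[ℂ] HB)) h2
  simp only [LinearMap.sum_apply, LinearMap.id_apply] at this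
  simp [this]

/-- Dropping the outer projection bounds each term by the trace of the compressed |s_j⟩⟨s_j| ⊗ 1,
which does not depend on i. The sum over j gives tr 1 = d_R, and the sum over i a factor d_S. -/
theorem compressedPurity_le {ι : Type*} [Fintype ι] (s : OrthonormalBasis ι ℂ HS) :
    compressedPurity HR s ≤ Module.finrank ℂ HR * Module.finrank ℂ HS := by
  have hcard : (Fintype.card ι : ℝ) = Module.finrank ℂ HS := by
    rw [Module.finrank_eq_card_basis s.toBasis]
  have key : ∀ i j, hilbertSchmidtSq (V := HR) (compress HR (systemOp HB (ketBra (s i) (s j)))) ≤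
      (LinearMap.trace ℂ HR (compress HR (systemOp HB (ketBra (s j) (s j))))).re := by
    intro i j
    rw [hilbertSchmidtSq_eq_sum _ (stdOrthonormalBasis ℂ HR),
      LinearMap.trace_eq_sum_inner _ (stdOrthonormalBasis ℂ HR), Complex.re_sum]
    refine Finset.sum_le_sum fun a _ => ?_
    set r : HR := stdOrthonormalBasis ℂ HR a
    have e : systemOp HB (ketBra (s j) (s j)) =
        (systemOp HB (ketBra (s i) (s j))).adjoint ∘ₗ systemOp HB (ketBra (s i) (s j)) := by
      rw [adjoint_systemOp_ketBra, ← TensorProduct.map_comp]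
      congr 1
      ext z
      simp
    rw [inner_compress, e, LinearMap.comp_apply (LinearMap.adjoint _),
      LinearMap.adjoint_inner_right]
    have h1 : ‖compress HR (systemOp HB (ketBra (s i) (s j))) r‖ ≤
        ‖systemOp HB (ketBra (s i) (s j)) (r : HS ⊗[ℂ] HB)‖ :=
      HR.norm_orthogonalProjectionOnto_apply_le _
    calc _ ≤ ‖systemOp HB (ketBra (s i) (s j)) (r : HS ⊗[ℂ] HB)‖ ^ 2 := by gcongr
      _ = _ := norm_sq_eq_re_inner (𝕜 := ℂ) _
  calc compressedPurity HR s ≤ ∑ _i : ι, ∑ j,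
        (LinearMap.trace ℂ HR (compress HR (systemOp HB (ketBra (s j) (s j))))).re :=
        Finset.sum_le_sum fun i _ => Finset.sum_le_sum fun j _ => key i j
    _ = ∑ _i : ι, (LinearMap.trace ℂ HR LinearMap.id).re := by
        rw [← sum_compress_diagonal HR s, map_sum, Complex.re_sum]
    _ = _ := by
        rw [LinearMap.trace_id, Finset.sum_const, Finset.card_univ, nsmul_eq_mul, hcard, mul_comm]
        simp

/-- Were every term zero, the diagonal compressions, which sum to the identity of H_R, would all
vanish. Positivity keeps the effective dimension from being a division by zero. -/
theorem compressedPurity_pos (hR : HR ≠ ⊥) {ι : Type*} [Fintype ι]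
    (s : OrthonormalBasis ι ℂ HS) : 0 < compressedPurity HR s := by
  have hnn : ∀ i j, 0 ≤
      hilbertSchmidtSq (V := HR) (compress HR (systemOp HB (ketBra (s i) (s j)))) :=
    fun i j => hilbertSchmidtSq_nonneg _
  refine lt_of_le_of_ne (Finset.sum_nonneg fun i _ => Finset.sum_nonneg fun j _ => hnn i j) ?_
  intro h0
  rw [eq_comm, compressedPurity, Finset.sum_eq_zero_iff_of_nonneg
    fun i _ => Finset.sum_nonneg fun j _ => hnn i j] at h0
  have hz : ∀ j, compress HR (systemOp HB (ketBra (s j) (s j))) = 0 := by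
    intro j
    have h1 := h0 j (Finset.mem_univ _)
    rw [Finset.sum_eq_zero_iff_of_nonneg fun k _ => hnn j k] at h1
    exact hilbertSchmidtSq_eq_zero (h1 j (Finset.mem_univ _))
  have h3 := sum_compress_diagonal HR s
  simp only [hz, Finset.sum_const_zero] at h3
  refine hR ((Submodule.eq_bot_iff _).2 fun x hx => ?_)
  have := congrArg (fun f => ((f ⟨x, hx⟩ : HR) : HS ⊗[ℂ] HB)) h3
  simpa using this.symm

end PartialTrace

end CanonicalTypicality

/-! ### Lévy's lemma on H_R, the Lipschitz constant and the mean -/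

namespace CanonicalTypicality
open InnerProductSpace

/-- Lévy's lemma for the uniform measure on the unit sphere of a complex Hilbert space. -/
theorem levy_concentration_complex {H : Type*} [NormedAddCommGroup H] [InnerProductSpace ℂ H]
    [FiniteDimensional ℂ H] [MeasurableSpace H] [BorelSpace H] [Nontrivial H] {g : H → ℝ} {L : ℝ}
    (hL : 0 < L) (hg : ∀ u v : H, ‖u‖ = 1 → ‖v‖ = 1 → |g u - g v| ≤ L * ‖u - v‖) {t : ℝ}
    (ht : 0 ≤ t) :
    (uniformSphere H).real {u | (∫ v, g (v : H) ∂uniformSphere H) + t ≤ g (u : H)} ≤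
      Real.exp (-((2 * (Module.finrank ℂ H : ℝ) - 1) * t ^ 2 / (36 * L ^ 2))) := by
  let _ : InnerProductSpace ℝ H := InnerProductSpace.complexToReal
  have hdim : Module.finrank ℝ H = 2 * Module.finrank ℂ H := finrank_real_of_complex H
  have hd : 0 < Module.finrank ℂ H := Module.finrank_pos
  have h := levy_concentration (E := H) (by omega) hL hg ht
  rw [hdim, Nat.cast_mul, Nat.cast_ofNat] at h
  exact h

theorem levy_concentration_submodule {V : Type*} [NormedAddCommGroup V] [InnerProductSpace ℂ V]
    [FiniteDimensional ℂ V] (K : Submodule ℂ V) [MeasurableSpace K] [BorelSpace K] [Nontrivial K]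
    {g : V → ℝ} {L : ℝ} (hL : 0 < L)
    (hg : ∀ u v : V, ‖u‖ = 1 → ‖v‖ = 1 → |g u - g v| ≤ L * ‖u - v‖) {t : ℝ} (ht : 0 ≤ t) :
    (uniformSphere K).real
        {u | (∫ v, g ((v : K) : V) ∂uniformSphere K) + t ≤ g ((u : K) : V)} ≤
      Real.exp (-((2 * (Module.finrank ℂ K : ℝ) - 1) * t ^ 2 / (36 * L ^ 2))) :=
  levy_concentration_complex (H := K) (g := fun x => g x) hL (fun u v hu hv => hg u v hu hv) ht

theorem continuous_of_lipschitz_on_sphere {V : Type*} [NormedAddCommGroup V]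
    [InnerProductSpace ℂ V] (K : Submodule ℂ V) {g : V → ℝ} {L : ℝ} (hL : 0 ≤ L)
    (hg : ∀ u v : V, ‖u‖ = 1 → ‖v‖ = 1 → |g u - g v| ≤ L * ‖u - v‖) :
    Continuous fun u : Metric.sphere (0 : K) 1 => g ((u : K) : V) := by
  have : LipschitzWith (Real.toNNReal L) fun u : Metric.sphere (0 : K) 1 => g ((u : K) : V) :=
    LipschitzWith.of_dist_le_mul fun x y => by
      rw [Real.dist_eq, Subtype.dist_eq, dist_eq_norm, Real.coe_toNNReal _ hL]
      exact hg _ _ (mem_sphere_zero_iff_norm.1 x.2) (mem_sphere_zero_iff_norm.1 y.2)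
  exact this.continuous

theorem integrable_of_continuous_on_sphere {V : Type*} [NormedAddCommGroup V]
    [InnerProductSpace ℂ V] [FiniteDimensional ℂ V] (K : Submodule ℂ V) [MeasurableSpace K]
    [BorelSpace K] [Nontrivial K] {g : V → ℝ}
    (hg : Continuous fun u : Metric.sphere (0 : K) 1 => g ((u : K) : V)) :
    Integrable (fun u : Metric.sphere (0 : K) 1 => g ((u : K) : V)) (uniformSphere K) :=
  haveI : ProperSpace K := FiniteDimensional.proper ℂ K
  hg.integrable_of_hasCompactSupport (HasCompactSupport.of_compactSpace _)

/-- Mean-square bound for a function dominated by centred quadratic forms. -/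
theorem integral_le_of_le_sum_sq {V : Type*} [NormedAddCommGroup V]
    [InnerProductSpace ℂ V] [FiniteDimensional ℂ V] (K : Submodule ℂ V) [MeasurableSpace K]
    [BorelSpace K] [Nontrivial K] {g : V → ℝ}
    (hg : Continuous fun u : Metric.sphere (0 : K) 1 => g ((u : K) : V))
    {ι : Type*} [Fintype ι] (X : ι → ι → (V →ₗ[ℂ] V)) {c : ℝ} (hc : 0 ≤ c)
    (h : ∀ φ : V, g φ ≤ c * ∑ i, ∑ j, ‖inner ℂ φ (X i j φ) -
      LinearMap.trace ℂ K (compress K (X i j)) / Module.finrank ℂ K‖ ^ 2) :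
    ∫ φ, g ((φ : K) : V) ∂uniformSphere K ≤
      c * ((∑ i, ∑ j, hilbertSchmidtSq (V := K) (compress K (X i j))) /
        (Module.finrank ℂ K : ℝ) ^ 2) := by
  set A : ι → ι → (K →ₗ[ℂ] K) := fun i j => compress K (X i j) with hA
  set q : ι → ι → K → ℝ := fun i j φ =>
    ‖inner ℂ φ (A i j φ) - LinearMap.trace ℂ K (A i j) / Module.finrank ℂ K‖ ^ 2 with hq
  have hqc : ∀ i j, Continuous (q i j) := by
    intro i j
    have : Continuous (A i j) := (A i j).continuous_of_finiteDimensional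
    simp only [hq]
    fun_prop
  have hpt : ∀ φ : K, g φ ≤ c * ∑ i, ∑ j, q i j φ := by
    intro φ
    simpa only [hq, hA, inner_compress] using h φ
  have hI : ∫ φ, c * ∑ i, ∑ j, q i j (φ : K) ∂uniformSphere K =
      c * ∑ i, ∑ j, ∫ φ, q i j (φ : K) ∂uniformSphere K := by
    rw [integral_const_mul, integral_finsetSum _ fun i _ =>
      integrable_uniformSphere (f := fun φ => ∑ j, q i j φ) (by fun_prop)]
    congr 1
    refine Finset.sum_congr rfl fun i _ => ?_
    rw [integral_finsetSum _ fun j _ => integrable_uniformSphere (hqc i j)]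
  refine (integral_mono (integrable_of_continuous_on_sphere K hg) (integrable_uniformSphere
    (f := fun φ => c * ∑ i, ∑ j, q i j φ) (by fun_prop)) fun φ => hpt φ).trans ?_
  rw [hI, Finset.sum_div]
  refine mul_le_mul_of_nonneg_left (Finset.sum_le_sum fun i _ => ?_) hc
  rw [Finset.sum_div]
  exact Finset.sum_le_sum fun j _ => integral_sq_inner_sub_trace_le (H := K) (A i j)

section Typicality

variable {HS HB : Type*} [NormedAddCommGroup HS] [InnerProductSpace ℂ HS]
  [FiniteDimensional ℂ HS] [NormedAddCommGroup HB] [InnerProductSpace ℂ HB]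
  [FiniteDimensional ℂ HB]

theorem norm_systemOp_apply_le {HS HB : Type*} [NormedAddCommGroup HS] [InnerProductSpace ℂ HS]
    [FiniteDimensional ℂ HS] [NormedAddCommGroup HB] [InnerProductSpace ℂ HB]
    {U : HS →ₗ[ℂ] HS} (hU : ∀ x, ‖U x‖ ≤ ‖x‖) (x : HS ⊗[ℂ] HB) :
    ‖systemOp HB U x‖ ≤ ‖x‖ := by
  have h1 : ‖LinearMap.toContinuousLinearMap U‖ ≤ 1 :=
    ContinuousLinearMap.opNorm_le_bound _ zero_le_one fun x => by simpa using hU x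
  have h2 := TensorProduct.norm_mapL_le (LinearMap.toContinuousLinearMap U)
    (ContinuousLinearMap.id ℂ HB)
  have h3 : ‖TensorProduct.mapL (LinearMap.toContinuousLinearMap U) (ContinuousLinearMap.id ℂ HB)‖
      ≤ 1 :=
    h2.trans (mul_le_one₀ h1 (norm_nonneg _) (ContinuousLinearMap.norm_id_le))
  have h4 := ContinuousLinearMap.le_of_opNorm_le _ h3 x
  rw [one_mul, TensorProduct.mapL_apply] at h4
  exact h4

theorem re_inner_apply_self_sub_le {V : Type*} [NormedAddCommGroup V] [InnerProductSpace ℂ V]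
    {B : V →ₗ[ℂ] V} (hB : ∀ x, ‖B x‖ ≤ ‖x‖) {φ ψ : V} (hφ : ‖φ‖ = 1) (hψ : ‖ψ‖ = 1) :
    (inner ℂ φ (B φ)).re - (inner ℂ ψ (B ψ)).re ≤ 2 * ‖φ - ψ‖ := by
  have e : (inner ℂ φ (B φ)).re - (inner ℂ ψ (B ψ)).re =
      (inner ℂ (φ - ψ) (B φ)).re + (inner ℂ ψ (B (φ - ψ))).re := by
    rw [map_sub, inner_sub_left, inner_sub_right, Complex.sub_re, Complex.sub_re]
    ring
  have b1 := (Complex.re_le_norm _).trans (norm_inner_le_norm (𝕜 := ℂ) (φ - ψ) (B φ))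
  have b2 := (Complex.re_le_norm _).trans (norm_inner_le_norm (𝕜 := ℂ) ψ (B (φ - ψ)))
  have c1 := hB φ
  have c2 := hB (φ - ψ)
  rw [hφ] at c1
  rw [hψ, one_mul] at b2
  have c3 := mul_le_mul_of_nonneg_left c1 (norm_nonneg (φ - ψ))
  linarith

/-- Test ψ with the contraction optimal for φ: Ω_S cancels, leaving a difference of quadratic forms
of U ⊗ 1. Duality replaces both the triangle inequality for the trace norm and its monotonicity
under partial trace. -/
theorem abs_traceNorm_sub_le (HR : Submodule ℂ (HS ⊗[ℂ] HB)) {φ ψ : HS ⊗[ℂ] HB}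
    (hφ : ‖φ‖ = 1) (hψ : ‖ψ‖ = 1) :
    |traceNorm (reducedState φ - omegaS HR) - traceNorm (reducedState ψ - omegaS HR)| ≤
      2 * ‖φ - ψ‖ := by
  have key : ∀ {φ ψ : HS ⊗[ℂ] HB}, ‖φ‖ = 1 → ‖ψ‖ = 1 →
      traceNorm (reducedState φ - omegaS HR) - traceNorm (reducedState ψ - omegaS HR) ≤
        2 * ‖φ - ψ‖ := by
    intro φ ψ hφ hψ
    obtain ⟨U, hU, hUφ⟩ :=
      exists_contraction_re_trace_comp_eq (reducedState_sub_omegaS_isSymmetric HR φ)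
    have hUψ := re_trace_comp_le_traceNorm (reducedState_sub_omegaS_isSymmetric HR ψ) hU
    rw [← hUφ]
    refine (sub_le_sub_left hUψ _).trans ?_
    rw [LinearMap.comp_sub, LinearMap.comp_sub, map_sub, map_sub, trace_comp_reducedState,
      trace_comp_reducedState, Complex.sub_re, Complex.sub_re, sub_sub_sub_cancel_right]
    exact re_inner_apply_self_sub_le (norm_systemOp_apply_le hU) hφ hψ
  rw [abs_le]
  refine ⟨?_, key hφ hψ⟩
  have := key hψ hφ
  rw [norm_sub_rev] at this
  linarith

theorem integral_sq_traceNorm_le (HR : Submodule ℂ (HS ⊗[ℂ] HB)) [Nontrivial HR]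
    [MeasurableSpace HR] [BorelSpace HR] {ι : Type*} [Fintype ι] (s : OrthonormalBasis ι ℂ HS)
    (hc : Continuous fun φ : Metric.sphere (0 : HR) 1 =>
      traceNorm (reducedState ((φ : HR) : HS ⊗[ℂ] HB) - omegaS HR) ^ 2) :
    ∫ φ, traceNorm (reducedState ((φ : HR) : HS ⊗[ℂ] HB) - omegaS HR) ^ 2 ∂uniformSphere HR ≤
      Module.finrank ℂ HS * (compressedPurity HR s / (Module.finrank ℂ HR : ℝ) ^ 2) := by
  refine integral_le_of_le_sum_sq HR
    (g := fun φ => traceNorm (reducedState φ - omegaS HR) ^ 2) hc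
    (fun i j => systemOp HB (ketBra (s i) (s j))) (Nat.cast_nonneg _) fun φ => ?_
  refine (traceNorm_sq_le (reducedState_sub_omegaS_isSymmetric HR φ) s).trans_eq ?_
  rw [Finset.sum_comm]
  congr 1
  refine Finset.sum_congr rfl fun i _ => Finset.sum_congr rfl fun j _ => ?_
  rw [LinearMap.sub_apply, inner_sub_right, inner_reducedState_apply, inner_omegaS_apply]

/-- Nonnegativity of the variance; it passes from the second moment of the trace norm to its mean.
-/
theorem sq_integral_le {Ω : Type*} [MeasurableSpace Ω] {μ : Measure Ω} [IsProbabilityMeasure μ]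
    {f : Ω → ℝ} (hf : Integrable f μ) (hf2 : Integrable (fun x => f x ^ 2) μ) :
    (∫ x, f x ∂μ) ^ 2 ≤ ∫ x, f x ^ 2 ∂μ := by
  have h : ∫ x, (f x ^ 2 - 2 * (∫ y, f y ∂μ) * f x + (∫ y, f y ∂μ) ^ 2) ∂μ =
      ∫ x, f x ^ 2 ∂μ - (∫ x, f x ∂μ) ^ 2 := by
    have := integral_add (hf2.sub (hf.const_mul (2 * (∫ y, f y ∂μ))))
      (integrable_const (μ := μ) ((∫ y, f y ∂μ) ^ 2))
    rw [integral_sub' hf2 (hf.const_mul _), integral_const_mul] at this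
    refine this.trans ?_
    simp only [integral_const, probReal_univ, smul_eq_mul, one_mul]
    ring
  have h0 : 0 ≤ ∫ x, (f x ^ 2 - 2 * (∫ y, f y ∂μ) * f x + (∫ y, f y ∂μ) ^ 2) ∂μ :=
    integral_nonneg fun x => by
      have := sq_nonneg (f x - ∫ y, f y ∂μ)
      simp only [Pi.zero_apply]
      linarith
  linarith

end Typicality

end CanonicalTypicality

end
-- Canonical typicality
open CanonicalTypicality in
theorem theorem1 {HS HB : Type*}
    [NormedAddCommGroup HS] [InnerProductSpace ℂ HS] [FiniteDimensional ℂ HS]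
    [NormedAddCommGroup HB] [InnerProductSpace ℂ HB] [FiniteDimensional ℂ HB]
    (HR : Submodule ℂ (HS ⊗[ℂ] HB)) (hR : HR ≠ ⊥)
    [MeasurableSpace HR] [BorelSpace HR] :
    (∀ ε : ℝ, 0 < ε →
      (uniformSphere HR).real
          {φ | ε + Real.sqrt ((Module.finrank ℂ HS : ℝ) / effDim HR) ≤
            traceNorm (reducedState ((φ : HR) : HS ⊗[ℂ] HB) - omegaS HR)} ≤
        2 * Real.exp (-(1 / (18 * Real.pi ^ 3) * (Module.finrank ℂ HR : ℝ) * ε ^ 2))) ∧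
    (Module.finrank ℂ HR : ℝ) / (Module.finrank ℂ HS : ℝ) ≤ effDim HR := by
  have : Nontrivial HR := Submodule.nontrivial_iff_ne_bot.2 hR
  have hd : (0 : ℝ) < Module.finrank ℂ HR := by exact_mod_cast Module.finrank_pos
  set s := stdOrthonormalBasis ℂ HS
  have hW := compressedPurity_pos HR hR s
  have hW' := compressedPurity_le HR s
  -- The purity sum is positive and at most d_R d_S, so d_S cannot be 0.
  have hS : (0 : ℝ) < Module.finrank ℂ HS := by
    by_contra h
    have h0 : (Module.finrank ℂ HS : ℝ) = 0 := le_antisymm (not_lt.1 h) (Nat.cast_nonneg _)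
    rw [h0, mul_zero] at hW'
    exact absurd hW hW'.not_gt
  have heff : effDim HR = (Module.finrank ℂ HR : ℝ) ^ 2 / compressedPurity HR s := by
    rw [effDim, re_trace_omegaB_sq HR s, one_div_div]
  refine ⟨fun ε hε => ?_, ?_⟩
  · set f : HS ⊗[ℂ] HB → ℝ := fun φ => traceNorm (reducedState φ - omegaS HR) with hf
    have hlip : ∀ u v : HS ⊗[ℂ] HB, ‖u‖ = 1 → ‖v‖ = 1 → |f u - f v| ≤ 2 * ‖u - v‖ :=
      fun u v hu hv => abs_traceNorm_sub_le HR hu hv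
    have hfc := continuous_of_lipschitz_on_sphere HR zero_le_two hlip
    have hfi := integrable_of_continuous_on_sphere HR hfc
    have hfi2 := integrable_of_continuous_on_sphere HR (g := fun φ => f φ ^ 2) (hfc.pow 2)
    have hmean : ∫ φ, f ((φ : HR) : HS ⊗[ℂ] HB) ∂uniformSphere HR ≤
        Real.sqrt ((Module.finrank ℂ HS : ℝ) / effDim HR) := by
      refine Real.le_sqrt_of_sq_le ((sq_integral_le hfi hfi2).trans ?_)
      refine (integral_sq_traceNorm_le HR s (hfc.pow 2)).trans_eq ?_
      rw [heff]
      field_simp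
    have hd1 : (1 : ℝ) ≤ Module.finrank ℂ HR := by
      exact_mod_cast Module.finrank_pos (R := ℂ) (M := HR)
    have levy := levy_concentration_submodule HR (g := f) (L := 2) (by norm_num) hlip hε.le
    calc _ ≤ (uniformSphere HR).real {u : Metric.sphere (0 : HR) 1 |
          (∫ v, f ((v : HR) : HS ⊗[ℂ] HB) ∂uniformSphere HR) + ε ≤ f ((u : HR) : HS ⊗[ℂ] HB)} := by
          refine measureReal_mono fun u hu => ?_
          simp only [Set.mem_ofPred_eq] at hu ⊢
          linarith
      _ ≤ _ := levy
      _ ≤ Real.exp (-(1 / (18 * Real.pi ^ 3) * (Module.finrank ℂ HR : ℝ) * ε ^ 2)) := by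
          refine Real.exp_le_exp.2 (neg_le_neg ?_)
          have hpi : (27 : ℝ) ≤ Real.pi ^ 3 := by
            have := pow_le_pow_left₀ (by norm_num) Real.pi_gt_three.le 3
            norm_num at this
            linarith
          -- Here 144 = 36·2² comes from Lévy's lemma with L = 2, and 18π³ ≥ 18·27 exceeds it. The
          -- remaining step is 2d_R − 1 ≥ d_R. The factor 2 in the theorem is slack, since only the
          -- upper tail is used.
          have hc : 1 / (18 * Real.pi ^ 3) ≤ 1 / 144 :=
            one_div_le_one_div_of_le (by norm_num) (by linarith)
          calc 1 / (18 * Real.pi ^ 3) * (Module.finrank ℂ HR : ℝ) * ε ^ 2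
              ≤ 1 / 144 * (Module.finrank ℂ HR : ℝ) * ε ^ 2 := by gcongr
            _ ≤ _ := by
                rw [le_div_iff₀ (by norm_num)]
                nlinarith [mul_nonneg (sub_nonneg.2 hd1) (sq_nonneg ε)]
      _ ≤ _ := by
          have := Real.exp_pos (-(1 / (18 * Real.pi ^ 3) * (Module.finrank ℂ HR : ℝ) * ε ^ 2))
          linarith
  · rw [heff, div_le_div_iff₀ hS hW]
    nlinarith
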